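/- Let $\mathcal K\subset\mathbb R^d$ ($d\ge 1$) be a compact convex set with non-empty interior, let $R,G>0$ with $\mathcal K\subseteq \mathcal B(R)=\{\|w\|\le R\}$, and let $\Psi$ be an $(M_\Psi,\nu)$-self-concordant barrier for $\mathcal K$: $\Psi:\operatorname{int}\mathcal K\to\mathbb R$ is convex and $C^3$, $\Psi(x_k)\to+\infty$ whenever $x_k\to x\in\partial\mathcal K$, $|\nabla^3\Psi(x)[u,u,u]|\le 2M_\Psi\|u\|^3_{\nabla^2\Psi(x)}$ for all $x\in\operatorname{int}\mathcal K$, $u\in\mathbb R^d$, and $\nabla\Psi(x)^\top\nabla^{-2}\Psi(x)\nabla\Psi(x)\le\nu$ for all $x\in\operatorname{int}\mathcal K$ (where $\|u\|_A=\sqrt{u^\top A u}$, $\nabla^{-2}=(\nabla^2)^{-1}$, $M_\Psi,\nu\ge 0$). Put $\Phi=\Psi+\frac{\nu}{2R^2}\|\cdot\|^2$. Oracles. For $w\in\operatorname{int}\mathcal K$ the gradient oracle returns $\mathcal O^{\rm grad}_\varepsilon(w)$ with $\|\mathcal O^{\rm grad}_\varepsilon(w)-\nabla\Psi(w)\|_{\nabla^{-2}\Psi(w)}\le\varepsilon$;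 the Hessian oracle returns a matrix $H$ and its inverse with $(1-\alpha)\nabla^2\Psi(w)\preceq H\preceq(1+\alpha)\nabla^2\Psi(w)$ and $(1-\alpha)\nabla^{-2}\Psi(w)\preceq H^{-1}\preceq(1+\alpha)\nabla^{-2}\Psi(w)$. Approximate gradients and Hessians of $\Phi$ at $w$ are obtained from one call of these by adding $\frac{\nu}{R^2}w$, respectively $\frac{\nu}{R^2}I$, followed in the second case by one matrix inversion. BARONS with parameters $\eta,\varepsilon,\alpha,m$: set $u_1=w_1=w^\star\in\operatorname{argmin}\Phi$, let $H_1$ be the approximate Hessian of $\Phi$ at $w^\star$, and $s_0=0$. In round $t=1,\dots,T$ it plays $w_t$, observes a subgradient $g_t\in\partial\ell_t(w_t)$ of a convex loss $\ell_t:\mathcal K\to\mathbb R$, sets $s_t=s_{t-1}+\eta g_t$, and starting from $w=w_t$ performs $m-1$ steps $w\leftarrow w-H_t^{-1}(\widehat\nabla+s_t)$, where $\widehat\nabla$ is the approximate gradient of $\Phi$ at the current $w$; the result is $w_{t+1}$. If $\|w_{t+1}-u_t\|_{H_t}\le 1/(41M_\Psi)$ then $u_{t+1}=u_t$, $H_{t+1}=H_t$;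 otherwise $u_{t+1}=w_{t+1}$ and $H_{t+1}$ is the approximate Hessian of $\Phi$ at $u_{t+1}$ (and its inverse is computed). Let $T\ge1$, $\eta=\frac{\nu}{RG}\sqrt{\frac{\log T+1}{T}}$, $\varepsilon=\sqrt{\nu/T}$, $\alpha=0.001$ and $m=\Theta(\log\frac1{\varepsilon M_\Psi})$ (with a large enough universal lower constant), and let $T$ be large enough that $\eta\le\frac1{1000\,b\,M_\Psi}$ with $b=RG/\sqrt\nu$, and $\varepsilon\le\frac1{20000M_\Psi}$. The losses may be chosen adaptively. If $\|g_t\|\le G$ for all $t\in[T]$, then $w_t\in\operatorname{int}\mathcal K$ for all $t\in[T]$ and $$\sum_{t=1}^T(\ell_t(w_t)-\ell_t(w))\le C\,RG\sqrt{T\log T}\qquad\text{for all } w\in\operatorname{int}\mathcal K .$$ Moreover, if a gradient oracle call costs $\mathcal C^{\rm grad}_\varepsilon(\Psi)$, a Hessian oracle call costs $\mathcal C^{\rm hess}_\alpha(\Psi)$, the inversion of a $d\times d$ matrix costs $\mathcal C^{\rm inv}$ and every arithmetic operation on reals costs $1$, then the total cost of BARONS over the $T$ rounds is at most $$C'\Big(\big(\mathcal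 C^{\rm grad}_\varepsilon(\Psi)+d^2\big)\,T\log\frac{T}{\nu M_\Psi^2}+\big(\mathcal C^{\rm hess}_\alpha(\Psi)+\mathcal C^{\rm inv}\big)\,M_\Psi\sqrt{T\nu\log T}\Big).$$ Here $C$ is a universal constant and $C'$ depends only on the constants hidden in the $\Theta(\cdot)$. -/

import Mathlib

open Filter Topology

noncomputable section

namespace Barons

/-- The space `ℝ^d` with its Euclidean norm. -/
abbrev Vec (d : ℕ) : Type := EuclideanSpace ℝ (Fin d)

/-- Real `d × d` matrices. -/
abbrev Mat (d : ℕ) : Type := Matrix (Fin d) (Fin d) ℝ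

/-! ### Self-concordant barriers -/

/-- The Hessian matrix `∇² f(x)`. -/
def hess {d : ℕ} (f : Vec d → ℝ) (x : Vec d) : Mat d :=
  Matrix.of fun i j =>
    iteratedFDeriv ℝ 2 f x ![EuclideanSpace.single i 1, EuclideanSpace.single j 1]

/-- The quadratic form `vᵀ A v`. -/
def quad {d : ℕ} (A : Mat d) (v : Vec d) : ℝ :=
  dotProduct v.ofLp (A.mulVec v.ofLp)

/-- The norm `‖v‖_A = √(vᵀ A v)`. -/
def matNorm {d : ℕ} (A : Mat d) (v : Vec d) : ℝ :=
  Real.sqrt (quad A v)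

/-- `f : int K → ℝ` is self-concordant with constant `M`. Only the values of `f` on `interior K`
matter. -/
structure IsSelfConcordant {d : ℕ} (K : Set (Vec d)) (f : Vec d → ℝ) (M : ℝ) : Prop where
  const_nonneg : 0 ≤ M
  convexOn : ConvexOn ℝ (interior K) f
  contDiffOn : ContDiffOn ℝ 3 f (interior K)
  tendsto_frontier : ∀ x ∈ frontier K, Tendsto f (𝓝[interior K] x) atTop
  third_le : ∀ x ∈ interior K, ∀ u : Vec d,
    |iteratedFDeriv ℝ 3 f x (fun _ => u)| ≤ 2 * M * matNorm (hess f x) u ^ 3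

/-- `f` is an `(M, ν)`-self-concordant barrier for `K`. -/
structure IsSelfConcordantBarrier {d : ℕ} (K : Set (Vec d)) (f : Vec d → ℝ) (M ν : ℝ) : Prop
    extends IsSelfConcordant K f M where
  param_nonneg : 0 ≤ ν
  gradient_le : ∀ w ∈ interior K, quad (hess f w)⁻¹ (gradient f w) ≤ ν

/-- The regularized barrier `Φ(w) = Ψ(w) + ν / (2 R²) ‖w‖²`. -/
def regBarrier {d : ℕ} (Ψ : Vec d → ℝ) (ν R : ℝ) (w : Vec d) : ℝ :=
  Ψ w + ν / (2 * R ^ 2) * ‖w‖ ^ 2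

/-! ### Oracles -/

/-- `O` is a gradient oracle for `f` on `int K` with tolerance `ε`. -/
def IsGradientOracle {d : ℕ} (K : Set (Vec d)) (f : Vec d → ℝ) (ε : ℝ)
    (O : Vec d → Vec d) : Prop :=
  ∀ w ∈ interior K, matNorm (hess f w)⁻¹ (O w - gradient f w) ≤ ε

/-- `O` is a Hessian oracle for `f` on `int K` with tolerance `α`: it returns a matrix `H` and its
inverse, which are `1 ± α` spectral approximations of the Hessian and of its inverse. -/
def IsHessianOracle {d : ℕ} (K : Set (Vec d)) (f : Vec d → ℝ) (α : ℝ)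
    (O : Vec d → Mat d × Mat d) : Prop :=
  ∀ w ∈ interior K,
    (O w).1 * (O w).2 = 1 ∧
    ((O w).1 - (1 - α) • hess f w).PosSemidef ∧
    ((1 + α) • hess f w - (O w).1).PosSemidef ∧
    ((O w).2 - (1 - α) • (hess f w)⁻¹).PosSemidef ∧
    ((1 + α) • (hess f w)⁻¹ - (O w).2).PosSemidef

/-! ### A real random access machine with oracles: computations that count their operations -/

/-- The operations that are counted: one call to the gradient oracle, one call to the Hessian
oracle, one inversion of a `d × d` matrix, one arithmetic operation (or square root, or comparison)
on real numbers. -/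
inductive Op : Type
  | gradCall
  | hessCall
  | matInv
  | arith
  deriving DecidableEq

/-- A tally: how often each operation was carried out. -/
abbrev Tally : Type := Op → ℕ

/-- The tally of a single operation. -/
def tick (o : Op) : Tally := Pi.single o 1

/-- The total price of a tally. -/
def Tally.price (n : Tally) (Cgrad Chess Cinv : ℝ) : ℝ :=
  Cgrad * n Op.gradCall + Chess * n Op.hessCall + Cinv * n Op.matInv + n Op.arith

/-- A computation: its result, and the operations carried out to obtain it. -/
structure Comp (α : Type) : Type where
  val : α
  ops : Tally

instance : Monad Comp where
  pure a := ⟨a, 0⟩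
  bind x f := ⟨(f x.val).val, x.ops + (f x.val).ops⟩

/-- Scalar addition. -/
def radd (x y : ℝ) : Comp ℝ := ⟨x + y, tick Op.arith⟩

/-- Scalar subtraction. -/
def rsub (x y : ℝ) : Comp ℝ := ⟨x - y, tick Op.arith⟩

/-- Scalar multiplication. -/
def rmul (x y : ℝ) : Comp ℝ := ⟨x * y, tick Op.arith⟩

/-- Square root of a scalar. -/
def rsqrt (x : ℝ) : Comp ℝ := ⟨Real.sqrt x, tick Op.arith⟩

/-- Comparison of two scalars. -/
def rle (x y : ℝ) : Comp Bool := ⟨decide (x ≤ y), tick Op.arith⟩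

/-- Compute the coordinates of a vector one after the other. -/
def forEach {d : ℕ} (f : Fin d → Comp ℝ) : Comp (Vec d) :=
  ⟨WithLp.toLp 2 fun i => (f i).val, ∑ i, (f i).ops⟩

/-- Compute `d` numbers one after the other, adding each to an accumulator. -/
def accumulate {d : ℕ} (f : Fin d → Comp ℝ) : Comp ℝ :=
  ⟨∑ i, (f i).val, ∑ i, ((f i).ops + tick Op.arith)⟩

/-- Sum of two vectors. -/
def vadd {d : ℕ} (x y : Vec d) : Comp (Vec d) := forEach fun i => radd (x i) (y i)

/-- Difference of two vectors. -/
def vsub {d : ℕ} (x y : Vec d) : Comp (Vec d) := forEach fun i => rsub (x i) (y i)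

/-- Multiple of a vector. -/
def vsmul {d : ℕ} (a : ℝ) (x : Vec d) : Comp (Vec d) := forEach fun i => rmul a (x i)

/-- Inner product of two vectors. -/
def vdot {d : ℕ} (x y : Vec d) : Comp ℝ := accumulate fun i => rmul (x i) (y i)

/-- Matrix-vector product. -/
def matVec {d : ℕ} (A : Mat d) (x : Vec d) : Comp (Vec d) :=
  forEach fun i => accumulate fun j => rmul (A i j) (x j)

/-- The norm `‖x‖_A`. -/
def normVia {d : ℕ} (A : Mat d) (x : Vec d) : Comp ℝ := do
  let y ← matVec A x
  let q ← vdot x y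
  rsqrt q

/-- Add the number `a` to every diagonal entry of a matrix. -/
def addDiag {d : ℕ} (A : Mat d) (a : ℝ) : Comp (Mat d) :=
  ⟨Matrix.of fun i j => if i = j then (radd (A i j) a).val else A i j,
    ∑ i, (radd (A i i) a).ops⟩

/-- Invert a matrix. -/
def invert {d : ℕ} (A : Mat d) : Comp (Mat d) := ⟨A⁻¹, tick Op.matInv⟩

/-- Call the gradient oracle `O` at `w`. -/
def callGrad {d : ℕ} (O : Vec d → Vec d) (w : Vec d) : Comp (Vec d) :=
  ⟨O w, tick Op.gradCall⟩

/-- Call the Hessian oracle `O` at `w`. -/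
def callHess {d : ℕ} (O : Vec d → Mat d × Mat d) (w : Vec d) : Comp (Mat d × Mat d) :=
  ⟨O w, tick Op.hessCall⟩

/-! ### The algorithm -/

/-- Gradient oracle for `Ψ + (a / 2) ‖·‖²`, from the gradient oracle `O` for `Ψ`. -/
def regGrad {d : ℕ} (O : Vec d → Vec d) (a : ℝ) (w : Vec d) : Comp (Vec d) := do
  let p ← callGrad O w
  let q ← vsmul a w
  vadd p q

/-- Hessian oracle for `Ψ + (a / 2) ‖·‖²`, from the Hessian oracle `O` for `Ψ`. -/
def regHess {d : ℕ} (O : Vec d → Mat d × Mat d) (a : ℝ) (w : Vec d) : Comp (Mat d × Mat d) := do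
  let P ← callHess O w
  let H ← addDiag P.1 a
  let Hinv ← invert H
  return (H, Hinv)

/-- What the algorithm stores at the start of round `t`: the iterate `w_t`, the landmark `u_t`,
the matrices `H_t` and `H_t⁻¹`, and the sum `s_{t-1}`. -/
structure Store (d : ℕ) : Type where
  w : Vec d
  u : Vec d
  H : Mat d
  Hinv : Mat d
  s : Vec d

/-- The inner loop: `n` approximate Newton steps
`w ← w - H⁻¹ (O(w) + s)` with the gradient oracle `gradO`. -/
def newtonSteps {d : ℕ} (gradO : Vec d → Comp (Vec d)) (Hinv : Mat d) (s : Vec d) :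
    ℕ → Vec d → Comp (Vec d)
  | 0, w => return w
  | n + 1, w => do
    let p ← gradO w
    let q ← vadd p s
    let r ← matVec Hinv q
    let w' ← vsub w r
    newtonSteps gradO Hinv s n w'

/-- One round of BARONS with step size `η`, Newton parameter `m`, self-concordance constant `M`
and subgradient `g`. -/
def oneRound {d : ℕ} (gradO : Vec d → Comp (Vec d)) (hessO : Vec d → Comp (Mat d × Mat d))
    (η M : ℝ) (m : ℕ) (g : Vec d) (σ : Store d) : Comp (Store d) := do
  let p ← vsmul η g
  let s' ← vadd σ.s p
  let w' ← newtonSteps gradO σ.Hinv s' (m - 1) σ.w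
  let v ← vsub w' σ.u
  let r ← normVia σ.H v
  let near ← rle r (1 / (41 * M))
  if near then
    return { w := w', u := σ.u, H := σ.H, Hinv := σ.Hinv, s := s' }
  else
    let P ← hessO w'
    return { w := w', u := w', H := P.1, Hinv := P.2, s := s' }

/-- BARONS, run for `t` rounds from `wstar` on the subgradients `g 0, …, g (t - 1)`. Rounds are
numbered from `0`, so the point played in round `t` is `(run … t).val.w`; it depends on
`g 0, …, g (t - 1)` only. -/
def run {d : ℕ} (gradO : Vec d → Comp (Vec d)) (hessO : Vec d → Comp (Mat d × Mat d))
    (η M : ℝ) (m : ℕ) (wstar : Vec d) (g : ℕ → Vec d) : ℕ → Comp (Store d)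
  | 0 => do
    let P ← hessO wstar
    return { w := wstar, u := wstar, H := P.1, Hinv := P.2, s := 0 }
  | t + 1 => do
    let σ ← run gradO hessO η M m wstar g t
    oneRound gradO hessO η M m (g t) σ

/-- `g` is a subgradient at `w` of the function `l` on `K`. -/
def IsSubgradient {d : ℕ} (K : Set (Vec d)) (l : Vec d → ℝ) (w g : Vec d) : Prop :=
  ∀ y ∈ K, l w + inner ℝ g (y - w) ≤ l y

end Barons

end

/-! BARONS is follow-the-regularized-leader with regularizer `Φ / η`, where each leader is computed
only approximately, by Newton steps that reuse an old Hessian. Let `wmin t` minimize `Φ + ⟨s, ·⟩`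
for the sum `s` of the first `t` scaled subgradients.

Tracking. The quadratic term of `Φ` makes its local norm at least `√ν / R` times the Euclidean one,
so `η • g t` has dual local norm at most `β = √ν q` with `q = √((log T + 1) / T)`. Self-concordance
makes the gradient strongly monotone in the local norm, so consecutive minimizers are `O(β)` apart
(`matNorm_minimizer_sub_le`). Within local distance about `0.03 / M` of a landmark all Hessians
agree with the stored matrix up to 10% (`IsLandmark.abs_quad_sub_le`), so a Newton step with that
matrix contracts the error by `0.1`, up to the oracle error, and logarithmically many steps reach
accuracy `O(ε)`. These facts form an invariant (`IsTracking`) that also keeps the iterates in `int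
K`.

Regret. The point played is `O(ε + β) = O(β)` from the leader of the next round, and playing that
leader has regret at most `(Φ y - Φ wstar) / η` (`be_the_leader`). The comparator is pulled towards
`wstar` by a fraction `1 / T`; the barrier grows only logarithmically along segments
(`line_sub_le`), so this gap is at most `ν (log T + 1)`. Both contributions are of order `R G √(T
log T)`.

Cost. The potential (landmark changes) / `(41 M)` + (distance to the landmark) grows by `O(ε + β)`
per round, which bounds the number of Hessian calls and inversions by `O(M √(T ν log T))`. The
inequality `1 ≤ M √ν` (`one_le_mul_sqrt`) makes `M` and `ν` positive and absorbs additive constants.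
-/

noncomputable section

namespace Barons

variable {d : ℕ}

/-! ### Quadratic forms -/

/-- The bilinear form `uᵀ A v`. -/
def bil (A : Mat d) (u v : Vec d) : ℝ := dotProduct u.ofLp (A.mulVec v.ofLp)

lemma quad_eq_bil (A : Mat d) (v : Vec d) : quad A v = bil A v v := rfl

lemma bil_add_left (A : Mat d) (u u' v : Vec d) : bil A (u + u') v = bil A u v + bil A u' v := by
  simp [bil, add_dotProduct]

lemma bil_add_right (A : Mat d) (u v v' : Vec d) : bil A u (v + v') = bil A u v + bil A u v' := by
  simp [bil, Matrix.mulVec_add, dotProduct_add]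

lemma bil_smul_left (A : Mat d) (c : ℝ) (u v : Vec d) : bil A (c • u) v = c * bil A u v := by
  simp [bil, smul_dotProduct]

lemma bil_smul_right (A : Mat d) (c : ℝ) (u v : Vec d) : bil A u (c • v) = c * bil A u v := by
  simp [bil, Matrix.mulVec_smul, dotProduct_smul]

lemma bil_neg_left (A : Mat d) (u v : Vec d) : bil A (-u) v = -bil A u v := by
  simpa using bil_smul_left A (-1) u v

lemma bil_neg_right (A : Mat d) (u v : Vec d) : bil A u (-v) = -bil A u v := by
  simpa using bil_smul_right A (-1) u v

lemma bil_sub_left (A : Mat d) (u u' v : Vec d) : bil A (u - u') v = bil A u v - bil A u' v := by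
  rw [sub_eq_add_neg, bil_add_left, bil_neg_left, sub_eq_add_neg]

lemma bil_sub_right (A : Mat d) (u v v' : Vec d) : bil A u (v - v') = bil A u v - bil A u v' := by
  rw [sub_eq_add_neg, bil_add_right, bil_neg_right, sub_eq_add_neg]

lemma bil_matrix_add (A B : Mat d) (u v : Vec d) : bil (A + B) u v = bil A u v + bil B u v := by
  simp [bil, Matrix.add_mulVec, dotProduct_add]

lemma bil_matrix_sub (A B : Mat d) (u v : Vec d) : bil (A - B) u v = bil A u v - bil B u v := by
  simp [bil, Matrix.sub_mulVec, dotProduct_sub]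

lemma bil_matrix_smul (c : ℝ) (A : Mat d) (u v : Vec d) : bil (c • A) u v = c * bil A u v := by
  simp [bil, Matrix.smul_mulVec, dotProduct_smul]

lemma bil_eq_inner (A : Mat d) (u v : Vec d) :
    bil A u v = inner ℝ u (WithLp.toLp 2 (A.mulVec v.ofLp)) := by
  simp [bil, EuclideanSpace.inner_eq_star_dotProduct, dotProduct_comm]

lemma bil_one (u v : Vec d) : bil (1 : Mat d) u v = inner ℝ u v := by
  rw [bil_eq_inner]; simp

lemma bil_comm {A : Mat d} (hA : A.IsSymm) (u v : Vec d) : bil A u v = bil A v u := by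
  unfold bil
  rw [Matrix.dotProduct_mulVec, dotProduct_comm, ← Matrix.mulVec_transpose, hA.eq]

lemma quad_add {A : Mat d} (hA : A.IsSymm) (u v : Vec d) :
    quad A (u + v) = quad A u + 2 * bil A u v + quad A v := by
  simp only [quad_eq_bil, bil_add_left, bil_add_right, bil_comm hA v u]; ring

lemma quad_sub {A : Mat d} (hA : A.IsSymm) (u v : Vec d) :
    quad A (u - v) = quad A u - 2 * bil A u v + quad A v := by
  simp only [quad_eq_bil, bil_sub_left, bil_sub_right, bil_comm hA v u]; ring

lemma quad_smul (A : Mat d) (c : ℝ) (v : Vec d) : quad A (c • v) = c ^ 2 * quad A v := by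
  simp only [quad_eq_bil, bil_smul_left, bil_smul_right]; ring

lemma quad_neg (A : Mat d) (v : Vec d) : quad A (-v) = quad A v := by
  simp only [quad_eq_bil, bil_neg_left, bil_neg_right]; ring

lemma matNorm_nonneg (A : Mat d) (v : Vec d) : 0 ≤ matNorm A v := Real.sqrt_nonneg _

lemma matNorm_sq {A : Mat d} {v : Vec d} (h : 0 ≤ quad A v) : matNorm A v ^ 2 = quad A v :=
  Real.sq_sqrt h

lemma matNorm_neg (A : Mat d) (v : Vec d) : matNorm A (-v) = matNorm A v := by
  rw [matNorm, quad_neg, matNorm]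

lemma matNorm_zero (A : Mat d) : matNorm A 0 = 0 := by
  simp [matNorm, quad]

lemma matNorm_sub_comm (A : Mat d) (u v : Vec d) : matNorm A (u - v) = matNorm A (v - u) := by
  rw [← matNorm_neg, neg_sub]

lemma matNorm_smul (A : Mat d) (c : ℝ) (v : Vec d) : matNorm A (c • v) = |c| * matNorm A v := by
  rw [matNorm, quad_smul, Real.sqrt_mul (sq_nonneg c), Real.sqrt_sq_eq_abs, matNorm]

lemma matNorm_le_of_quad_le {A B : Mat d} {v : Vec d} {c : ℝ} (hc : 0 ≤ c)
    (h : quad A v ≤ c ^ 2 * quad B v) : matNorm A v ≤ c * matNorm B v := by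
  unfold matNorm
  refine (Real.sqrt_le_sqrt h).trans ?_
  rw [Real.sqrt_mul (sq_nonneg c), Real.sqrt_sq hc]

/-- A symmetric bilinear form dominated on the diagonal by `κ` times a positive semidefinite form
is dominated off the diagonal too. -/
lemma abs_bil_le_of_abs_quad_le {S H : Mat d} (hS : S.IsSymm) (hH : H.IsSymm) {κ : ℝ}
    (hH0 : ∀ v, 0 ≤ quad H v) (h : ∀ v, |quad S v| ≤ κ * quad H v) (u v : Vec d) :
    |bil S u v| ≤ |κ| * (matNorm H u * matNorm H v) := by
  -- Polarization: the upper bound at `t • u + v` minus the lower bound at `t • u - v` gives a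
  -- quadratic in `t` that is nowhere negative; its discriminant is the claim.
  have key : ∀ t : ℝ, 0 ≤ (κ * quad H u) * (t * t) + (-2 * bil S u v) * t + κ * quad H v := by
    intro t
    have h1 := (abs_le.1 (h (t • u + v))).2
    have h2 := (abs_le.1 (h (t • u - v))).1
    rw [quad_add hS, quad_add hH, quad_smul, quad_smul, bil_smul_left, bil_smul_left] at h1
    rw [quad_sub hS, quad_sub hH, quad_smul, quad_smul, bil_smul_left, bil_smul_left] at h2
    nlinarith
  have hd := discrim_le_zero key
  unfold discrim at hd
  apply abs_le_of_sq_le_sq _ (mul_nonneg (abs_nonneg _)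
    (mul_nonneg (matNorm_nonneg _ _) (matNorm_nonneg _ _)))
  rw [mul_pow, mul_pow, sq_abs, matNorm_sq (hH0 u), matNorm_sq (hH0 v)]
  nlinarith

lemma abs_bil_le {H : Mat d} (hH : H.IsSymm) (hH0 : ∀ v, 0 ≤ quad H v) (u v : Vec d) :
    |bil H u v| ≤ matNorm H u * matNorm H v := by
  simpa using abs_bil_le_of_abs_quad_le hH hH (κ := 1) hH0
    (fun v => by rw [abs_of_nonneg (hH0 v), one_mul]) u v

lemma matNorm_add_le {H : Mat d} (hH : H.IsSymm) (hH0 : ∀ v, 0 ≤ quad H v) (u v : Vec d) :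
    matNorm H (u + v) ≤ matNorm H u + matNorm H v := by
  apply abs_le_of_sq_le_sq' _ (add_nonneg (matNorm_nonneg _ _) (matNorm_nonneg _ _)) |>.2
  rw [matNorm_sq (hH0 _), quad_add hH, add_sq, matNorm_sq (hH0 _), matNorm_sq (hH0 _)]
  have := (abs_le.1 (abs_bil_le hH hH0 u v)).2
  linarith

lemma matNorm_sub_le {H : Mat d} (hH : H.IsSymm) (hH0 : ∀ v, 0 ≤ quad H v) (u v w : Vec d) :
    matNorm H (u - w) ≤ matNorm H (u - v) + matNorm H (v - w) := by
  have := matNorm_add_le hH hH0 (u - v) (v - w)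
  rwa [sub_add_sub_cancel] at this

lemma quad_nonneg_of_pos {A : Mat d} (h : ∀ v, v ≠ 0 → 0 < quad A v) (v : Vec d) :
    0 ≤ quad A v := by
  by_cases hv : v = 0
  · simp [hv, quad]
  · exact (h v hv).le

lemma isUnit_det_of_quad_pos {A : Mat d} (h : ∀ v, v ≠ 0 → 0 < quad A v) : IsUnit A.det := by
  rw [isUnit_iff_ne_zero]
  intro h0
  obtain ⟨v, hv, hv0⟩ := Matrix.exists_mulVec_eq_zero_iff.2 h0
  have := h (WithLp.toLp 2 v) (by simpa using hv)
  simp [quad, hv0] at this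

lemma bil_inv_mulVec {A : Mat d} (hA : A.IsSymm) (hu : IsUnit A.det) (e z : Vec d) :
    bil A (WithLp.toLp 2 (A⁻¹.mulVec e.ofLp)) z = inner ℝ e z := by
  rw [bil_comm hA, bil_eq_inner]
  simp [Matrix.mulVec_mulVec, Matrix.mul_nonsing_inv A hu, real_inner_comm]

lemma quad_inv_mulVec {A : Mat d} (hA : A.IsSymm) (hu : IsUnit A.det) (e : Vec d) :
    quad A (WithLp.toLp 2 (A⁻¹.mulVec e.ofLp)) = quad A⁻¹ e := by
  rw [quad_eq_bil, bil_inv_mulVec hA hu, quad_eq_bil, bil_eq_inner]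

lemma abs_inner_le_dual {A : Mat d} (hA : A.IsSymm) (h : ∀ v, v ≠ 0 → 0 < quad A v)
    (e z : Vec d) : |inner ℝ e z| ≤ matNorm A⁻¹ e * matNorm A z := by
  have h0 := quad_nonneg_of_pos h
  have hu := isUnit_det_of_quad_pos h
  rw [← bil_inv_mulVec hA hu]
  refine (abs_bil_le hA h0 _ _).trans (le_of_eq ?_)
  rw [matNorm, quad_inv_mulVec hA hu, matNorm, matNorm]

lemma posSemidef_sub_quad_le {A B : Mat d} (h : (B - A).PosSemidef) (v : Vec d) :
    quad A v ≤ quad B v := by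
  have := h.dotProduct_mulVec_nonneg v.ofLp
  simp only [star_trivial] at this
  change 0 ≤ bil (B - A) v v at this
  rw [bil_matrix_sub] at this
  simp only [quad_eq_bil]; linarith

/-! ### Second and third derivatives -/

lemma vec_eq_sum (u : Vec d) : u = ∑ i, u i • EuclideanSpace.single i (1 : ℝ) := by
  ext j
  simp [Finset.sum_apply, Pi.single_apply]

lemma bil_hess (f : Vec d → ℝ) (x u v : Vec d) :
    bil (hess f x) u v = fderiv ℝ (fderiv ℝ f) x u v := by
  conv_rhs => rw [vec_eq_sum u, vec_eq_sum v]
  simp only [map_sum, map_smul, sum_apply, smul_apply,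
    smul_eq_mul]
  simp only [bil, dotProduct, Matrix.mulVec, hess, Matrix.of_apply, iteratedFDeriv_two_apply,
    Finset.mul_sum]
  refine Finset.sum_comm.trans (Finset.sum_congr rfl fun i _ => Finset.sum_congr rfl fun j _ => ?_)
  simp [mul_comm, mul_left_comm]

lemma hess_isSymm {f : Vec d → ℝ} {x : Vec d} (hf : ContDiffAt ℝ 3 f x) : (hess f x).IsSymm := by
  have hs : IsSymmSndFDerivAt ℝ f x := hf.isSymmSndFDerivAt (by simp; norm_num)
  ext i j
  simp only [hess, Matrix.transpose_apply, Matrix.of_apply, iteratedFDeriv_two_apply]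
  exact hs _ _

/-- The third derivative as a trilinear form. -/
def third (f : Vec d → ℝ) (x u v w : Vec d) : ℝ := fderiv ℝ (fderiv ℝ (fderiv ℝ f)) x u v w

lemma iteratedFDeriv_three_apply (f : Vec d → ℝ) (x : Vec d) (m : Fin 3 → Vec d) :
    iteratedFDeriv ℝ 3 f x m = third f x (m 0) (m 1) (m 2) := by
  rw [iteratedFDeriv_succ_apply_right, iteratedFDeriv_two_apply]
  rfl

section
variable {f : Vec d → ℝ} {x : Vec d}

lemma contDiffAt_fderiv (hf : ContDiffAt ℝ 3 f x) : ContDiffAt ℝ 2 (fderiv ℝ f) x :=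
  hf.fderiv_right (by norm_num)

lemma contDiffAt_fderiv_fderiv (hf : ContDiffAt ℝ 3 f x) :
    ContDiffAt ℝ 1 (fderiv ℝ (fderiv ℝ f)) x :=
  (contDiffAt_fderiv hf).fderiv_right (by norm_num)

lemma hasFDerivAt_bil_hess (hf : ContDiffAt ℝ 3 f x) (v w : Vec d) :
    HasFDerivAt (fun y => bil (hess f y) v w)
      (((ContinuousLinearMap.apply ℝ ℝ w).comp (ContinuousLinearMap.apply ℝ (Vec d →L[ℝ] ℝ) v)).comp
        (fderiv ℝ (fderiv ℝ (fderiv ℝ f)) x)) x := by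
  have h := ((contDiffAt_fderiv_fderiv hf).differentiableAt one_ne_zero).hasFDerivAt
  simp only [bil_hess]
  exact (((ContinuousLinearMap.apply ℝ ℝ w).comp
    (ContinuousLinearMap.apply ℝ (Vec d →L[ℝ] ℝ) v)).hasFDerivAt).comp x h

lemma third_comm_left (hf : ContDiffAt ℝ 3 f x) (u v w : Vec d) :
    third f x u v w = third f x v u w := by
  have : IsSymmSndFDerivAt ℝ (fderiv ℝ f) x := (contDiffAt_fderiv hf).isSymmSndFDerivAt (by simp)
  unfold third
  rw [this u v]

/-- The Hessian is symmetric on a whole neighbourhood of `x`, so the symmetry can be differentiated.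
-/
lemma third_comm_right (hf : ContDiffAt ℝ 3 f x) (u v w : Vec d) :
    third f x u v w = third f x u w v := by
  have h1 := hasFDerivAt_bil_hess hf v w
  have h2 := hasFDerivAt_bil_hess hf w v
  have he : (fun y => bil (hess f y) v w) =ᶠ[𝓝 x] fun y => bil (hess f y) w v := by
    filter_upwards [hf.eventually (by simp)] with y hy
    exact bil_comm (hess_isSymm hy) _ _
  have := (h2.congr_of_eventuallyEq he).unique h1
  have := congrArg (fun L => L u) this
  simpa [third] using this.symm

/-- The bound on the diagonal of the third derivative gives a bound off the diagonal, here with the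
constant `5 / 4`. -/
lemma abs_third_le (hf : ContDiffAt ℝ 3 f x) {M : ℝ} (hM : 0 ≤ M)
    (hpos : ∀ v, v ≠ 0 → 0 < quad (hess f x) v)
    (h : ∀ u, |third f x u u u| ≤ 2 * M * matNorm (hess f x) u ^ 3) (u v : Vec d) :
    |third f x u v v| ≤
      2 * (5 / 4 * M) * (matNorm (hess f x) u * matNorm (hess f x) v ^ 2) := by
  have hS := hess_isSymm hf
  have hq : ∀ v, 0 ≤ quad (hess f x) v := quad_nonneg_of_pos hpos
  set N := matNorm (hess f x) with hN
  have N0 : ∀ u, 0 ≤ N u := fun u => matNorm_nonneg _ _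
  have expand : ∀ (u : Vec d) (s : ℝ), third f x (v + s • u) (v + s • u) (v + s • u)
      = third f x v v v + 3 * s * third f x u v v + 3 * s ^ 2 * third f x u u v
        + s ^ 3 * third f x u u u := by
    intro u s
    have e1 : third f x v u v = third f x u v v := third_comm_left hf v u v
    have e2 : third f x v v u = third f x u v v := by rw [third_comm_right hf, e1]
    have e3 : third f x u v u = third f x u u v := third_comm_right hf u v u
    have e4 : third f x v u u = third f x u u v := by rw [third_comm_left hf, e3]
    unfold third at *
    simp only [map_add, map_smul, add_apply, smul_apply,
      smul_eq_mul, e1, e2, e3, e4]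
    ring
  have cubes : ∀ a b : ℝ, 0 ≤ a → 0 ≤ b → ∀ r : ℝ, 0 ≤ r → a ^ 2 + b ^ 2 = 5 / 2 * r ^ 2 →
      a ≤ 3 / 2 * r → b ≤ 3 / 2 * r → a ^ 3 + b ^ 3 ≤ 7 / 2 * r ^ 3 := by
    -- `a ^ 3` is a convex function of `a ^ 2`; the right side is its chord between `a = r / 2` and
    -- `a = 3 r / 2`. As `a ^ 2 + b ^ 2` is prescribed, summing two chords gives the extremal value
    -- `7 / 2 * r ^ 3`.
    have one : ∀ a r : ℝ, 0 ≤ r → r / 2 ≤ a → a ≤ 3 / 2 * r →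
        a ^ 3 ≤ 13 / 8 * r * a ^ 2 - 9 / 32 * r ^ 3 := by
      intro a r hr h1 h2
      nlinarith [mul_nonneg (mul_nonneg (sub_nonneg.2 h1) (sub_nonneg.2 h2))
        (show 0 ≤ a + 3 / 8 * r by linarith)]
    intro a b ha hb r hr hab h1 h2
    have h3 : r / 2 ≤ a := by nlinarith
    have h4 : r / 2 ≤ b := by nlinarith
    have e1 := one a r hr h3 h1
    have e2 := one b r hr h4 h2
    nlinarith
  -- The difference of the cubic form at `v + u' / 2` and `v - u' / 2` is `3 T(u', v, v) + T(u', u',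
  -- u') / 4`. Hence `3 |T(u', v, v)| ≤ 2 M (7 / 2 + 1 / 4) N v ^ 3`, which is where `5 / 4` comes
  -- from. General `u` follows by scaling to the norm of `v`.
  have main : ∀ u' : Vec d, N u' = N v → |third f x u' v v| ≤ 5 / 2 * M * N v ^ 3 := by
    intro u' hu'
    have e1 := expand u' (1 / 2)
    have e2 := expand u' (-(1 / 2))
    have h1 := abs_le.1 (h (v + (1 / 2 : ℝ) • u'))
    have h2 := abs_le.1 (h (v + (-(1 / 2) : ℝ) • u'))
    have h3 := abs_le.1 (h u')
    have t1 := matNorm_add_le hS hq v ((1 / 2 : ℝ) • u')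
    have t2 := matNorm_add_le hS hq v ((-(1 / 2) : ℝ) • u')
    rw [matNorm_smul, ← hN, hu', abs_of_nonneg (by norm_num)] at t1
    rw [matNorm_smul, ← hN, hu', abs_of_nonpos (by norm_num)] at t2
    have hsq : N (v + (1 / 2 : ℝ) • u') ^ 2 + N (v + (-(1 / 2) : ℝ) • u') ^ 2
        = 5 / 2 * N v ^ 2 := by
      have hu2 : quad (hess f x) u' = quad (hess f x) v := by
        rw [← matNorm_sq (hq u'), ← matNorm_sq (hq v), ← hN, hu']
      rw [hN, matNorm_sq (hq _), matNorm_sq (hq _), matNorm_sq (hq _), quad_add hS, quad_add hS,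
        quad_smul, quad_smul, bil_smul_right, bil_smul_right, hu2]
      ring
    have hc := cubes _ _ (N0 _) (N0 _) (N v) (N0 v) hsq (by linarith) (by linarith)
    rw [hu'] at h3
    have hMc := mul_le_mul_of_nonneg_left hc hM
    rw [e1] at h1
    rw [e2] at h2
    rw [abs_le]
    constructor <;> linarith
  have hT0 : u = 0 ∨ v = 0 → third f x u v v = 0 := by
    rintro (rfl | rfl) <;> simp [third]
  by_cases hu : u = 0
  · rw [hT0 (Or.inl hu), abs_zero]; have := N0 u; have := N0 v; positivity
  by_cases hv : v = 0
  · rw [hT0 (Or.inr hv), abs_zero]; have := N0 u; have := N0 v; positivity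
  have hNu : 0 < N u := Real.sqrt_pos.2 (hpos u hu)
  have hNv : 0 < N v := Real.sqrt_pos.2 (hpos v hv)
  have := main ((N v / N u) • u) (by
    rw [hN, matNorm_smul, ← hN, abs_of_pos (by positivity), div_mul_cancel₀ _ hNu.ne'])
  have hlin : third f x ((N v / N u) • u) v v = N v / N u * third f x u v v := by
    simp [third]
  rw [hlin, abs_mul, abs_of_pos (by positivity), div_mul_eq_mul_div, div_le_iff₀ hNu] at this
  refine le_of_mul_le_mul_left (this.trans (le_of_eq ?_)) hNv
  ring

/-! ### Derivatives along lines -/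

lemma inner_gradient (f : Vec d → ℝ) (x z : Vec d) : inner ℝ (gradient f x) z = fderiv ℝ f x z := by
  simp [gradient]

lemma hasDerivAt_line_point (x v : Vec d) (t : ℝ) : HasDerivAt (fun s : ℝ => x + s • v) v t := by
  simpa using ((hasDerivAt_id t).smul_const v).const_add x

variable {v z : Vec d} {t : ℝ}

lemma hasDerivAt_line (hf : ContDiffAt ℝ 3 f (x + t • v)) :
    HasDerivAt (fun s : ℝ => f (x + s • v)) (inner ℝ (gradient f (x + t • v)) v) t := by
  rw [inner_gradient]
  exact (hf.differentiableAt (by norm_num)).hasFDerivAt.comp_hasDerivAt t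
    (hasDerivAt_line_point x v t)

lemma hasDerivAt_inner_gradient_line (hf : ContDiffAt ℝ 3 f (x + t • v)) :
    HasDerivAt (fun s : ℝ => inner ℝ (gradient f (x + s • v)) z)
      (bil (hess f (x + t • v)) v z) t := by
  simp only [inner_gradient, bil_hess]
  have h := ((contDiffAt_fderiv hf).differentiableAt two_ne_zero).hasFDerivAt
  have h2 := h.comp_hasDerivAt t (hasDerivAt_line_point x v t)
  exact ((ContinuousLinearMap.apply ℝ ℝ z).hasFDerivAt).comp_hasDerivAt t h2

lemma hasDerivAt_quad_hess_line (hf : ContDiffAt ℝ 3 f (x + t • v)) :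
    HasDerivAt (fun s : ℝ => quad (hess f (x + s • v)) z) (third f (x + t • v) v z z) t :=
  ((hasFDerivAt_bil_hess hf z z).comp_hasDerivAt t (hasDerivAt_line_point x v t) :)

end

/-! ### The regularized barrier -/

/-- The inner product as a bilinear map. -/
def innerCLM (d : ℕ) : Vec d →L[ℝ] Vec d →L[ℝ] ℝ := innerSL ℝ

@[simp] lemma innerCLM_apply (x y : Vec d) : innerCLM d x y = inner ℝ x y := rfl

section
variable {Ψ : Vec d → ℝ} {ν R : ℝ} {x : Vec d}

lemma contDiffAt_regBarrier (hf : ContDiffAt ℝ 3 Ψ x) : ContDiffAt ℝ 3 (regBarrier Ψ ν R) x :=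
  hf.add (contDiffAt_const.mul (contDiffAt_id.norm_sq ℝ))

lemma fderiv_regBarrier (hf : ContDiffAt ℝ 3 Ψ x) :
    fderiv ℝ (regBarrier Ψ ν R) x = fderiv ℝ Ψ x + (ν / R ^ 2) • innerCLM d x := by
  have h1 := (hf.differentiableAt (by norm_num)).hasFDerivAt
  have h2 := ((hasStrictFDerivAt_norm_sq x).hasFDerivAt).const_mul (ν / (2 * R ^ 2))
  have h3 : HasFDerivAt (regBarrier Ψ ν R) _ x := h1.add h2
  rw [h3.fderiv]
  ext z
  simp only [add_apply, smul_apply, innerCLM_apply, innerSL_apply_apply, smul_eq_mul, nsmul_eq_mul]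
  push_cast
  ring

lemma fderiv_fderiv_regBarrier (hf : ContDiffAt ℝ 3 Ψ x) :
    fderiv ℝ (fderiv ℝ (regBarrier Ψ ν R)) x
      = fderiv ℝ (fderiv ℝ Ψ) x + (ν / R ^ 2) • innerCLM d := by
  have he : fderiv ℝ (regBarrier Ψ ν R) =ᶠ[𝓝 x]
      fun y => fderiv ℝ Ψ y + (ν / R ^ 2) • innerCLM d y := by
    filter_upwards [hf.eventually (by simp)] with y hy using fderiv_regBarrier hy
  rw [he.fderiv_eq]
  have h1 := ((contDiffAt_fderiv hf).differentiableAt two_ne_zero).hasFDerivAt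
  have h2 := ((innerCLM d).hasFDerivAt (x := x)).const_smul (ν / R ^ 2)
  exact (h1.add h2).fderiv

lemma third_regBarrier (hf : ContDiffAt ℝ 3 Ψ x) (u v w : Vec d) :
    third (regBarrier Ψ ν R) x u v w = third Ψ x u v w := by
  have he : fderiv ℝ (fderiv ℝ (regBarrier Ψ ν R)) =ᶠ[𝓝 x]
      fun y => fderiv ℝ (fderiv ℝ Ψ) y + (ν / R ^ 2) • innerCLM d := by
    filter_upwards [hf.eventually (by simp)] with y hy using fderiv_fderiv_regBarrier hy
  have h := ((contDiffAt_fderiv_fderiv hf).differentiableAt one_ne_zero).hasFDerivAt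
  have h2 := (h.add_const ((ν / R ^ 2) • innerCLM d)).congr_of_eventuallyEq he
  unfold third
  rw [h2.fderiv]

lemma hess_regBarrier (hf : ContDiffAt ℝ 3 Ψ x) :
    hess (regBarrier Ψ ν R) x = hess Ψ x + (ν / R ^ 2) • 1 := by
  ext i j
  simp [hess, iteratedFDeriv_two_apply, fderiv_fderiv_regBarrier hf, Matrix.one_apply,
    EuclideanSpace.inner_single_left, innerCLM_apply]

lemma quad_hess_regBarrier (hf : ContDiffAt ℝ 3 Ψ x) (v : Vec d) :
    quad (hess (regBarrier Ψ ν R) x) v = quad (hess Ψ x) v + ν / R ^ 2 * ‖v‖ ^ 2 := by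
  rw [hess_regBarrier hf, quad_eq_bil, bil_matrix_add, bil_matrix_smul, bil_one,
    real_inner_self_eq_norm_sq, quad_eq_bil]

lemma gradient_regBarrier (hf : ContDiffAt ℝ 3 Ψ x) :
    gradient (regBarrier Ψ ν R) x = gradient Ψ x + (ν / R ^ 2) • x := by
  refine ext_inner_right ℝ fun z => ?_
  rw [inner_gradient, fderiv_regBarrier hf, inner_add_left, inner_gradient, inner_smul_left]
  simp

end

end Barons

namespace Barons

/-! ### One-variable comparison lemmas -/

lemma le_of_hasDerivAt_nonneg {f f' : ℝ → ℝ} {a b : ℝ} (hab : a ≤ b)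
    (hf : ∀ t ∈ Set.Icc a b, HasDerivAt f (f' t) t) (h0 : ∀ t ∈ Set.Icc a b, 0 ≤ f' t) :
    f a ≤ f b :=
  monotoneOn_of_hasDerivWithinAt_nonneg (convex_Icc a b)
    (fun t ht => (hf t ht).continuousAt.continuousWithinAt)
    (fun t ht => (hf t (interior_subset ht)).hasDerivWithinAt)
    (fun t ht => h0 t (interior_subset ht)) (Set.left_mem_Icc.2 hab) (Set.right_mem_Icc.2 hab) hab

lemma sub_le_sub_of_hasDerivAt_le {f f' g g' : ℝ → ℝ} {a b : ℝ} (hab : a ≤ b)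
    (hf : ∀ t ∈ Set.Icc a b, HasDerivAt f (f' t) t)
    (hg : ∀ t ∈ Set.Icc a b, HasDerivAt g (g' t) t)
    (h : ∀ t ∈ Set.Icc a b, f' t ≤ g' t) : f b - f a ≤ g b - g a := by
  have := le_of_hasDerivAt_nonneg (f := fun t => g t - f t) (f' := fun t => g' t - f' t) hab
    (fun t ht => (hg t ht).sub (hf t ht)) (fun t ht => sub_nonneg.2 (h t ht))
  linarith

lemma le_quadratic_of_second_deriv_le {φ φ' φ'' : ℝ → ℝ} {T C : ℝ} (hT : 0 ≤ T)
    (h1 : ∀ t ∈ Set.Icc 0 T, HasDerivAt φ (φ' t) t)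
    (h2 : ∀ t ∈ Set.Icc 0 T, HasDerivAt φ' (φ'' t) t)
    (h : ∀ t ∈ Set.Icc 0 T, φ'' t ≤ C) : φ T ≤ φ 0 + φ' 0 * T + C * T ^ 2 / 2 := by
  have h3 : ∀ t ∈ Set.Icc 0 T, φ' t ≤ φ' 0 + C * t := by
    intro t ht
    have := sub_le_sub_of_hasDerivAt_le (g := fun s => C * s) (g' := fun _ => C) ht.1
      (fun s hs => h2 s ⟨hs.1, hs.2.trans ht.2⟩)
      (fun s _ => by simpa using (hasDerivAt_id s).const_mul C)
      (fun s hs => h s ⟨hs.1, hs.2.trans ht.2⟩)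
    linarith
  have := sub_le_sub_of_hasDerivAt_le (g := fun s => φ' 0 * s + C / 2 * s ^ 2)
    (g' := fun s => φ' 0 + C * s) hT h1
    (fun s _ => by
      have e1 := (hasDerivAt_id s).const_mul (φ' 0)
      have e2 := (hasDerivAt_pow 2 s).const_mul (C / 2)
      exact (e1.add e2).congr_deriv (by norm_num; ring)) h3
  nlinarith

/-- If `|h'| ≤ c h^{3/2}`, then `h` vanishes as soon as it vanishes initially. -/
lemma eq_zero_of_deriv_le_pow {h h' : ℝ → ℝ} {T c : ℝ} (hT : 0 ≤ T) (hc : 0 ≤ c)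
    (hd : ∀ t ∈ Set.Icc 0 T, HasDerivAt h (h' t) t) (h0 : ∀ t ∈ Set.Icc 0 T, 0 ≤ h t)
    (hb : ∀ t ∈ Set.Icc 0 T, |h' t| ≤ c * Real.sqrt (h t) ^ 3) (hz : h 0 = 0) : h T = 0 := by
  have hcont : ContinuousOn (fun t => Real.sqrt (h t)) (Set.Icc 0 T) := fun t ht =>
    (hd t ht).continuousAt.sqrt.continuousWithinAt
  obtain ⟨B, hB⟩ := isCompact_Icc.bddAbove_image hcont
  have hB' : ∀ t ∈ Set.Icc 0 T, Real.sqrt (h t) ≤ B := fun t ht => hB ⟨t, ht, rfl⟩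
  -- Grönwall: with `√h ≤ B` on the compact interval, `h' ≤ c B h`, so `h · exp (-c B t)` is
  -- nonincreasing.
  have key := le_of_hasDerivAt_nonneg (f := fun t => -(h t * Real.exp (-(c * B) * t)))
    (f' := fun t => -(h' t * Real.exp (-(c * B) * t) +
      h t * (Real.exp (-(c * B) * t) * (-(c * B) * 1)))) hT
    (fun t ht => ((hd t ht).mul (((hasDerivAt_id t).const_mul (-(c * B))).exp)).neg) (by
      intro t ht
      have e1 := (abs_le.1 (hb t ht)).2
      have e2 : Real.sqrt (h t) ^ 3 ≤ B * h t := by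
        have : Real.sqrt (h t) ^ 3 = Real.sqrt (h t) * h t := by
          rw [pow_succ, Real.sq_sqrt (h0 t ht), mul_comm]
        rw [this]
        exact mul_le_mul_of_nonneg_right (hB' t ht) (h0 t ht)
      have e3 := mul_le_mul_of_nonneg_left e2 hc
      have e4 := Real.exp_pos (-(c * B) * t)
      have : h' t - c * B * h t ≤ 0 := by linarith
      nlinarith)
  simp only [hz, zero_mul, neg_zero, Left.nonneg_neg_iff] at key
  have e := Real.exp_pos (-(c * B) * T)
  have := h0 T (Set.right_mem_Icc.2 hT)
  nlinarith

/-- If `h > 0` and `|h'| ≤ 2 M h^{3/2}`, then `h^{-1/2}` is `M`-Lipschitz. -/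
lemma abs_inv_sqrt_sub_le {h h' : ℝ → ℝ} {T M : ℝ} (hT : 0 ≤ T)
    (hd : ∀ t ∈ Set.Icc 0 T, HasDerivAt h (h' t) t) (h0 : ∀ t ∈ Set.Icc 0 T, 0 < h t)
    (hb : ∀ t ∈ Set.Icc 0 T, |h' t| ≤ 2 * M * Real.sqrt (h t) ^ 3) :
    |(Real.sqrt (h T))⁻¹ - (Real.sqrt (h 0))⁻¹| ≤ M * T := by
  have hder : ∀ t ∈ Set.Icc 0 T, HasDerivAt (fun s => (Real.sqrt (h s))⁻¹)
      (-(h' t / (2 * Real.sqrt (h t))) / Real.sqrt (h t) ^ 2) t := fun t ht =>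
    ((hd t ht).sqrt (h0 t ht).ne').inv (Real.sqrt_pos.2 (h0 t ht)).ne'
  have hlin : ∀ c : ℝ, ∀ t ∈ Set.Icc 0 T, HasDerivAt (fun s => c * s) c t := fun c t _ => by
    simpa using (hasDerivAt_id t).const_mul c
  have hbd : ∀ t ∈ Set.Icc 0 T,
      |-(h' t / (2 * Real.sqrt (h t))) / Real.sqrt (h t) ^ 2| ≤ M := by
    intro t ht
    have hs := Real.sqrt_pos.2 (h0 t ht)
    rw [abs_div, abs_neg, abs_div, abs_of_pos (show 0 < 2 * Real.sqrt (h t) by positivity),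
      abs_of_pos (show 0 < Real.sqrt (h t) ^ 2 by positivity), div_div, div_le_iff₀ (by positivity)]
    refine (hb t ht).trans (le_of_eq ?_)
    ring
  have h1 := sub_le_sub_of_hasDerivAt_le hT hder (hlin M) fun t ht => (abs_le.1 (hbd t ht)).2
  have h2 := sub_le_sub_of_hasDerivAt_le hT (hlin (-M)) hder fun t ht => (abs_le.1 (hbd t ht)).1
  rw [abs_le]
  constructor <;> linarith

variable {d : ℕ} {K : Set (Vec d)} {f : Vec d → ℝ} {M : ℝ} {x v y z : Vec d}

/-! ### Leaving a bounded set along a line -/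

/-- The exit times in `[0, T]` form a nonempty compact set, and `s` is its least element; it is
positive since `x` is interior. -/
lemma exists_exit (hx : x ∈ interior K) {T : ℝ} (hT : 0 < T) (hv : x + T • v ∉ interior K) :
    ∃ s : ℝ, 0 < s ∧ x + s • v ∈ frontier K ∧ ∀ t ∈ Set.Ico 0 s, x + t • v ∈ interior K := by
  have hc : Continuous fun t : ℝ => x + t • v := by fun_prop
  have hclosed : IsClosed {t : ℝ | x + t • v ∉ interior K} :=
    (isOpen_interior.preimage hc).isClosed_compl
  obtain ⟨s, ⟨hs, hs'⟩, hmin⟩ := (isCompact_Icc.inter_right hclosed).exists_isLeast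
    (s := Set.Icc 0 T ∩ {t : ℝ | x + t • v ∉ interior K}) ⟨T, ⟨hT.le, le_rfl⟩, hv⟩
  have hin : ∀ t ∈ Set.Ico 0 s, x + t • v ∈ interior K := fun t ht => by
    by_contra h
    exact absurd (hmin ⟨⟨ht.1, ht.2.le.trans hs.2⟩, h⟩) (not_le.2 ht.2)
  have hs0 : 0 < s := by
    rcases hs.1.eq_or_lt with h | h
    · exact absurd hx (by simpa [← h] using hs')
    · exact h
  refine ⟨s, hs0, ⟨?_, hs'⟩, hin⟩
  refine mem_closure_of_tendsto (f := fun t : ℝ => x + t • v) (b := 𝓝[<] s)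
    (hc.continuousAt.tendsto.mono_left nhdsWithin_le_nhds) ?_
  filter_upwards [Ico_mem_nhdsLT hs0] with t ht using interior_subset (hin t ht)

lemma exists_not_mem_of_isBounded (hK : Bornology.IsBounded K) (hv : v ≠ 0) :
    ∃ T : ℝ, 0 < T ∧ x + T • v ∉ interior K := by
  obtain ⟨C, hC⟩ := hK.exists_norm_le
  have hv' : 0 < ‖v‖ := norm_pos_iff.2 hv
  refine ⟨(|C| + ‖x‖ + 1) / ‖v‖, by positivity, fun h => ?_⟩
  have h1 := hC _ (interior_subset h)
  have h2 : ‖((|C| + ‖x‖ + 1) / ‖v‖) • v‖ = |C| + ‖x‖ + 1 := by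
    rw [norm_smul, Real.norm_of_nonneg (by positivity), div_mul_cancel₀ _ hv'.ne']
  have h3 := norm_sub_le (x + ((|C| + ‖x‖ + 1) / ‖v‖) • v) x
  rw [add_sub_cancel_left, h2] at h3
  have := le_abs_self C
  linarith

/-! ### Self-concordant functions -/

namespace IsSelfConcordant

lemma contDiffAt (hf : IsSelfConcordant K f M) (hx : x ∈ interior K) : ContDiffAt ℝ 3 f x :=
  hf.contDiffOn.contDiffAt (isOpen_interior.mem_nhds hx)

lemma isSymm (hf : IsSelfConcordant K f M) (hx : x ∈ interior K) : (hess f x).IsSymm :=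
  hess_isSymm (hf.contDiffAt hx)

lemma abs_third_diag_le (hf : IsSelfConcordant K f M) (hx : x ∈ interior K) (u : Vec d) :
    |third f x u u u| ≤ 2 * M * matNorm (hess f x) u ^ 3 := by
  simpa [iteratedFDeriv_three_apply] using hf.third_le x hx u

/-- The barrier property in the form used for contradictions: any argument that bounds `f` along a
line up to the exit time shows that there is no such exit. -/
lemma not_bounded_to_exit (hf : IsSelfConcordant K f M) {s : ℝ} (hs : 0 < s)
    (hfr : x + s • v ∈ frontier K) (hin : ∀ t ∈ Set.Ico 0 s, x + t • v ∈ interior K) (C : ℝ) :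
    ¬ ∀ t ∈ Set.Ico 0 s, f (x + t • v) ≤ C := by
  intro h
  have hc : Continuous fun t : ℝ => x + t • v := by fun_prop
  have hev : ∀ᶠ t in 𝓝[<] s, t ∈ Set.Ico 0 s := Ico_mem_nhdsLT hs
  have ht : Tendsto (fun t : ℝ => x + t • v) (𝓝[<] s) (𝓝[interior K] (x + s • v)) :=
    tendsto_nhdsWithin_iff.2 ⟨hc.continuousAt.tendsto.mono_left nhdsWithin_le_nhds,
      hev.mono fun t ht => hin t ht⟩
  have h2 := ((hf.tendsto_frontier _ hfr).comp ht).eventually_gt_atTop C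
  obtain ⟨t, ht1, ht2⟩ := (h2.and hev).exists
  exact absurd (h t ht2) (not_le.2 ht1)

/-- The derivative of a convex function along a line is monotone, so its own derivative is
nonnegative. -/
lemma quad_nonneg (hf : IsSelfConcordant K f M) (hx : x ∈ interior K) (v : Vec d) :
    0 ≤ quad (hess f x) v := by
  have hc : Continuous fun t : ℝ => x + t • v := by fun_prop
  set S : Set ℝ := {t | x + t • v ∈ interior K} with hS
  have hSo : IsOpen S := isOpen_interior.preimage hc
  have h0 : (0 : ℝ) ∈ S := by simpa [hS] using hx
  have hconv : ConvexOn ℝ S fun t => f (x + t • v) := by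
    have := hf.convexOn.comp_affineMap (AffineMap.lineMap x (x + v) : ℝ →ᵃ[ℝ] Vec d)
    convert! this using 1
    · ext t; simp [hS, AffineMap.lineMap_apply, add_comm]
    · ext t; simp [AffineMap.lineMap_apply, add_comm]
  have hd : ∀ t ∈ S, HasDerivAt (fun t : ℝ => f (x + t • v))
      (inner ℝ (gradient f (x + t • v)) v) t := fun t ht => hasDerivAt_line (hf.contDiffAt ht)
  have hmono := hconv.monotoneOn_deriv fun t ht => (hd t ht).differentiableAt
  have hmono' : MonotoneOn (fun t : ℝ => inner ℝ (gradient f (x + t • v)) v) S := by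
    intro a ha b hb hab
    have := hmono ha hb hab
    rwa [(hd a ha).deriv, (hd b hb).deriv] at this
  have h2 : HasDerivAt (fun t : ℝ => inner ℝ (gradient f (x + t • v)) v)
      (bil (hess f (x + (0 : ℝ) • v)) v v) 0 :=
    hasDerivAt_inner_gradient_line (hf.contDiffAt h0)
  have h3 := hmono'.derivWithin_nonneg (x := 0)
  rw [derivWithin_of_isOpen hSo h0, h2.deriv] at h3
  simpa [quad_eq_bil] using h3

lemma line_mem (hK : Convex ℝ K) (hx : x ∈ interior K) {T : ℝ} (hy : x + T • v ∈ interior K)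
    {t : ℝ} (ht : t ∈ Set.Icc 0 T) : x + t • v ∈ interior K := by
  rcases ht.1.eq_or_lt with h | h
  · simpa [← h] using hx
  have hT : 0 < T := h.trans_le ht.2
  have := hK.interior hx hy (a := 1 - t / T) (b := t / T)
    (sub_nonneg.2 ((div_le_one hT).2 ht.2)) (div_nonneg ht.1 hT.le) (by ring)
  convert this using 1
  rw [smul_add, smul_smul, div_mul_cancel₀ _ hT.ne', ← add_assoc, ← add_smul]
  simp

/-- A self-concordant function on a bounded set has a nondegenerate Hessian. -/
lemma quad_pos (hf : IsSelfConcordant K f M) (hK : Bornology.IsBounded K)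
    (hx : x ∈ interior K) (hv : v ≠ 0) : 0 < quad (hess f x) v := by
  refine (hf.quad_nonneg hx v).lt_of_ne fun hzero => ?_
  obtain ⟨T, hT, hout⟩ := exists_not_mem_of_isBounded (x := x) hK hv
  obtain ⟨s, hs, hfr, hin⟩ := exists_exit hx hT hout
  refine hf.not_bounded_to_exit (x := x) (v := v) hs hfr hin
    (|f x| + |inner ℝ (gradient f x) v| * s) fun t ht => ?_
  have hin' : ∀ r ∈ Set.Icc 0 t, x + r • v ∈ interior K :=
    fun r hr => hin r ⟨hr.1, hr.2.trans_lt ht.2⟩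
  -- A degenerate direction stays degenerate along its line, so `f` is affine there, hence bounded
  -- up to the exit from the bounded set.
  have hz : ∀ r ∈ Set.Icc 0 t, quad (hess f (x + r • v)) v = 0 := fun r hr =>
    eq_zero_of_deriv_le_pow (h := fun r => quad (hess f (x + r • v)) v)
      (h' := fun r => third f (x + r • v) v v v) hr.1
      (mul_nonneg zero_le_two hf.const_nonneg)
      (fun q hq => hasDerivAt_quad_hess_line (hf.contDiffAt (hin' q ⟨hq.1, hq.2.trans hr.2⟩)))
      (fun q hq => hf.quad_nonneg (hin' q ⟨hq.1, hq.2.trans hr.2⟩) v)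
      (fun q hq => hf.abs_third_diag_le (hin' q ⟨hq.1, hq.2.trans hr.2⟩) v) (by simpa using hzero.symm)
  have := le_quadratic_of_second_deriv_le (φ := fun r => f (x + r • v)) (C := 0) ht.1
    (fun r hr => hasDerivAt_line (hf.contDiffAt (hin' r hr)))
    (fun r hr => hasDerivAt_inner_gradient_line (hf.contDiffAt (hin' r hr)))
    (fun r hr => (hz r hr).le)
  simp only [zero_smul, add_zero, zero_mul, zero_div] at this
  refine this.trans (add_le_add (le_abs_self _) ?_)
  exact mul_le_mul (le_abs_self _) ht.2.le ht.1 (abs_nonneg _)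

end IsSelfConcordant

end Barons

namespace Barons

variable {d : ℕ} {K : Set (Vec d)} {f : Vec d → ℝ} {M ν : ℝ} {x v y z : Vec d}

/-! ### Local norms along lines, the Dikin ellipsoid, Hessian comparison and minimizers -/

namespace IsSelfConcordant

lemma matNorm_pos (hf : IsSelfConcordant K f M) (hb : Bornology.IsBounded K)
    (hx : x ∈ interior K) (hv : v ≠ 0) : 0 < matNorm (hess f x) v :=
  Real.sqrt_pos.2 (hf.quad_pos hb hx hv)

lemma abs_inv_matNorm_sub_le (hf : IsSelfConcordant K f M) (hb : Bornology.IsBounded K)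
    (hv : v ≠ 0) {T : ℝ} (hT : 0 ≤ T) (hin : ∀ t ∈ Set.Icc 0 T, x + t • v ∈ interior K) :
    |(matNorm (hess f (x + T • v)) v)⁻¹ - (matNorm (hess f x) v)⁻¹| ≤ M * T := by
  have := abs_inv_sqrt_sub_le (h := fun r => quad (hess f (x + r • v)) v)
    (h' := fun r => third f (x + r • v) v v v) (M := M) hT
    (fun t ht => hasDerivAt_quad_hess_line (hf.contDiffAt (hin t ht)))
    (fun t ht => hf.quad_pos hb (hin t ht) hv)
    (fun t ht => hf.abs_third_diag_le (hin t ht) v)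
  simpa [matNorm] using this

/-- Along a line the local norm of the direction grows at most hyperbolically. -/
lemma matNorm_line_le (hf : IsSelfConcordant K f M) (hb : Bornology.IsBounded K)
    {T : ℝ} (hT : 0 ≤ T) (hin : ∀ t ∈ Set.Icc 0 T, x + t • v ∈ interior K)
    (h1 : M * matNorm (hess f x) v * T < 1) :
    matNorm (hess f (x + T • v)) v
      ≤ matNorm (hess f x) v / (1 - M * matNorm (hess f x) v * T) := by
  by_cases hv : v = 0
  · simp [hv, matNorm_zero]
  have hx : x ∈ interior K := by simpa using hin 0 ⟨le_rfl, hT⟩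
  have p0 := hf.matNorm_pos hb hx hv
  have p1 := hf.matNorm_pos hb (hin T ⟨hT, le_rfl⟩) hv
  have := (abs_le.1 (hf.abs_inv_matNorm_sub_le hb hv hT hin)).1
  set a := matNorm (hess f x) v
  set b := matNorm (hess f (x + T • v)) v
  rw [le_div_iff₀ (by linarith)]
  have e := mul_le_mul_of_nonneg_left this (mul_pos p0 p1).le
  have e1 : a * b * (b⁻¹ - a⁻¹) = a - b := by field_simp
  rw [e1] at e
  linarith

lemma le_matNorm_line (hf : IsSelfConcordant K f M) (hb : Bornology.IsBounded K)
    {T : ℝ} (hT : 0 ≤ T) (hin : ∀ t ∈ Set.Icc 0 T, x + t • v ∈ interior K) :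
    matNorm (hess f x) v / (1 + M * matNorm (hess f x) v * T)
      ≤ matNorm (hess f (x + T • v)) v := by
  by_cases hv : v = 0
  · simp [hv, matNorm_zero]
  have hx : x ∈ interior K := by simpa using hin 0 ⟨le_rfl, hT⟩
  have p0 := hf.matNorm_pos hb hx hv
  have p1 := hf.matNorm_pos hb (hin T ⟨hT, le_rfl⟩) hv
  have := (abs_le.1 (hf.abs_inv_matNorm_sub_le hb hv hT hin)).2
  have hM := hf.const_nonneg
  set a := matNorm (hess f x) v
  set b := matNorm (hess f (x + T • v)) v
  rw [div_le_iff₀ (by positivity)]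
  have e := mul_le_mul_of_nonneg_left this (mul_pos p0 p1).le
  have e1 : a * b * (b⁻¹ - a⁻¹) = a - b := by field_simp
  rw [e1] at e
  linarith

/-- The Dikin ellipsoid of radius `1 / M` lies in the domain. -/
lemma dikin_mem (hf : IsSelfConcordant K f M) (hb : Bornology.IsBounded K)
    (hx : x ∈ interior K) (h1 : M * matNorm (hess f x) v < 1) : x + v ∈ interior K := by
  by_contra hout
  obtain ⟨s, hs, hfr, hin⟩ := exists_exit (v := v) hx one_pos (by simpa using hout)
  have hs1 : s ≤ 1 := by
    by_contra h
    exact hout (by simpa using hin 1 ⟨zero_le_one, not_le.1 h⟩)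
  have hM := hf.const_nonneg
  set r := matNorm (hess f x) v with hr
  have r0 : 0 ≤ r := matNorm_nonneg _ _
  set C := (r / (1 - M * r)) ^ 2 with hC
  refine hf.not_bounded_to_exit (x := x) (v := v) hs hfr hin
    (f x + |inner ℝ (gradient f x) v| + C / 2) fun t ht => ?_
  have hin' : ∀ q ∈ Set.Icc 0 t, x + q • v ∈ interior K :=
    fun q hq => hin q ⟨hq.1, hq.2.trans_lt ht.2⟩
  have ht1 : t ≤ 1 := ht.2.le.trans hs1
  -- If the line left the domain by time 1, the second derivative would be at most `C` up to the
  -- exit, so `f` would stay bounded.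
  have hbd : ∀ q ∈ Set.Icc 0 t, quad (hess f (x + q • v)) v ≤ C := by
    intro q hq
    have hMr : M * r * q ≤ M * r :=
      mul_le_of_le_one_right (mul_nonneg hM r0) (hq.2.trans ht1)
    have := hf.matNorm_line_le hb hq.1 (fun p hp => hin' p ⟨hp.1, hp.2.trans hq.2⟩)
      (hMr.trans_lt h1)
    rw [← matNorm_sq (hf.quad_nonneg (hin' q hq) v)]
    refine pow_le_pow_left₀ (matNorm_nonneg _ _) (this.trans ?_) 2
    exact div_le_div_of_nonneg_left r0 (by linarith) (by linarith)
  have := le_quadratic_of_second_deriv_le (φ := fun r => f (x + r • v)) (C := C) ht.1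
    (fun r hr => hasDerivAt_line (hf.contDiffAt (hin' r hr)))
    (fun r hr => hasDerivAt_inner_gradient_line (hf.contDiffAt (hin' r hr))) hbd
  simp only [zero_smul, add_zero] at this
  have e1 : inner ℝ (gradient f x) v * t ≤ |inner ℝ (gradient f x) v| :=
    (mul_le_mul_of_nonneg_right (le_abs_self _) ht.1).trans
      (mul_le_of_le_one_right (abs_nonneg _) ht1)
  have e2 : C * t ^ 2 ≤ C :=
    mul_le_of_le_one_right (sq_nonneg _) (pow_le_one₀ ht.1 ht1)
  linarith

lemma segment_mem (hK : Convex ℝ K) (hx : x ∈ interior K) (hy : y ∈ interior K) {t : ℝ}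
    (ht : t ∈ Set.Icc (0 : ℝ) 1) : x + t • (y - x) ∈ interior K :=
  line_mem hK hx (T := 1) (by simpa using hy) ht

/-- Strong monotonicity of the gradient of a self-concordant function. -/
lemma inner_gradient_sub_ge (hf : IsSelfConcordant K f M) (hb : Bornology.IsBounded K)
    (hK : Convex ℝ K) (hx : x ∈ interior K) (hy : y ∈ interior K) :
    matNorm (hess f x) (y - x) ^ 2 / (1 + M * matNorm (hess f x) (y - x))
      ≤ inner ℝ (gradient f y - gradient f x) (y - x) := by
  set v := y - x with hv
  set r := matNorm (hess f x) v with hr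
  have r0 : 0 ≤ r := matNorm_nonneg _ _
  have hM := hf.const_nonneg
  have hin : ∀ t ∈ Set.Icc (0 : ℝ) 1, x + t • v ∈ interior K := fun t ht => segment_mem hK hx hy ht
  have hpos : ∀ t ∈ Set.Icc (0 : ℝ) 1, 0 < 1 + M * r * t := fun t ht => by
    have := mul_nonneg (mul_nonneg hM r0) ht.1; linarith
  -- The comparison function is the antiderivative of the squared lower bound `(r / (1 + M r t)) ^
  -- 2` for the local norm.
  have := sub_le_sub_of_hasDerivAt_le (f := fun t => r ^ 2 * t / (1 + M * r * t))
    (f' := fun t => (r / (1 + M * r * t)) ^ 2)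
    (g := fun t : ℝ => inner ℝ (gradient f (x + t • v)) v)
    (g' := fun t => bil (hess f (x + t • v)) v v) zero_le_one
    (fun t ht => by
      have e1 := (hasDerivAt_id t).const_mul (r ^ 2)
      have e2 := ((hasDerivAt_id t).const_mul (M * r)).const_add 1
      have hne := (hpos t ht).ne'
      refine (e1.div e2 hne).congr_deriv ?_
      simp only [id]
      field_simp
      ring)
    (fun t ht => hasDerivAt_inner_gradient_line (hf.contDiffAt (hin t ht)))
    (fun t ht => by
      change _ ≤ quad _ _
      rw [← matNorm_sq (hf.quad_nonneg (hin t ht) v)]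
      exact pow_le_pow_left₀ (div_nonneg r0 (hpos t ht).le)
        (hf.le_matNorm_line hb ht.1 fun q hq => hin q ⟨hq.1, hq.2.trans ht.2⟩) 2)
  have hxy : x + (1 : ℝ) • v = y := by simp [hv]
  rw [hxy] at this
  simp only [mul_one, mul_zero, zero_smul, add_zero, zero_div, sub_zero] at this
  rwa [inner_sub_left]

/-- Comparison of the Hessians at nearby points. -/
lemma quad_hess_compare (hf : IsSelfConcordant K f M) (hb : Bornology.IsBounded K)
    (hK : Convex ℝ K) (hx : x ∈ interior K) (hy : y ∈ interior K) {ρ : ℝ}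
    (hρ : 5 / 4 * M * matNorm (hess f x) (y - x) ≤ ρ) (hρ1 : ρ < 1) (z : Vec d) :
    quad (hess f y) z * (1 - ρ) ^ 2 ≤ quad (hess f x) z ∧
    (1 - ρ) ^ 2 * quad (hess f x) z ≤ quad (hess f y) z := by
  set v := y - x with hv
  set r := matNorm (hess f x) v with hr
  have r0 : 0 ≤ r := matNorm_nonneg _ _
  have hM := hf.const_nonneg
  have hMr : 0 ≤ M * r := mul_nonneg hM r0
  have ρ0 : 0 ≤ ρ := le_trans (by positivity) hρ
  have hxy : x + (1 : ℝ) • v = y := by simp [hv]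
  have hin : ∀ t ∈ Set.Icc (0 : ℝ) 1, x + t • v ∈ interior K := fun t ht => segment_mem hK hx hy ht
  have hpos : ∀ t ∈ Set.Icc (0 : ℝ) 1, 0 < 1 - ρ * t := fun t ht => by
    have := mul_le_of_le_one_right ρ0 ht.2; linarith
  -- A linear differential inequality for the form at the fixed vector `z`: it makes `q(t) (1 - ρ t)
  -- ^ 2` nonincreasing and `q(t) / (1 - ρ t) ^ 2` nondecreasing. The factor `5 / 4` in `ρ` is that
  -- of `abs_third_le`.
  have hthird : ∀ t ∈ Set.Icc (0 : ℝ) 1, |third f (x + t • v) v z z| * (1 - ρ * t)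
      ≤ 2 * ρ * quad (hess f (x + t • v)) z := by
    intro t ht
    have h1 := abs_third_le (hf.contDiffAt (hin t ht)) hM
      (fun w hw => hf.quad_pos hb (hin t ht) hw) (hf.abs_third_diag_le (hin t ht)) v z
    have hMρ : M * r * t ≤ ρ * t := mul_le_mul_of_nonneg_right (by linarith) ht.1
    have hlt : M * r * t < 1 := by have := hpos t ht; linarith
    have h2 := hf.matNorm_line_le (v := v) hb ht.1 (fun q hq => hin q ⟨hq.1, hq.2.trans ht.2⟩) hlt
    rw [← hr] at h2
    have h3 : matNorm (hess f (x + t • v)) v * (1 - ρ * t) ≤ r := by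
      rw [le_div_iff₀ (by linarith)] at h2
      refine le_trans ?_ h2
      exact mul_le_mul_of_nonneg_left (by linarith) (matNorm_nonneg _ _)
    have q0 := hf.quad_nonneg (hin t ht) z
    rw [matNorm_sq q0] at h1
    calc |third f (x + t • v) v z z| * (1 - ρ * t)
        ≤ 2 * (5 / 4 * M) * (matNorm (hess f (x + t • v)) v * quad (hess f (x + t • v)) z)
          * (1 - ρ * t) := mul_le_mul_of_nonneg_right h1 (hpos t ht).le
      _ = 2 * (5 / 4 * M) * quad (hess f (x + t • v)) z
          * (matNorm (hess f (x + t • v)) v * (1 - ρ * t)) := by ring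
      _ ≤ 2 * (5 / 4 * M) * quad (hess f (x + t • v)) z * r :=
          mul_le_mul_of_nonneg_left h3 (by positivity)
      _ = 2 * (5 / 4 * M * r) * quad (hess f (x + t • v)) z := by ring
      _ ≤ 2 * ρ * quad (hess f (x + t • v)) z := by gcongr
  have hq : ∀ t ∈ Set.Icc (0 : ℝ) 1, HasDerivAt (fun t : ℝ => quad (hess f (x + t • v)) z)
      (third f (x + t • v) v z z) t := fun t ht =>
    hasDerivAt_quad_hess_line (hf.contDiffAt (hin t ht))
  have hl : ∀ t : ℝ, HasDerivAt (fun t : ℝ => 1 - ρ * t) (-ρ) t := fun t => by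
    simpa using ((hasDerivAt_id t).const_mul ρ).const_sub 1
  have up := le_of_hasDerivAt_nonneg
    (f := fun t : ℝ => -(quad (hess f (x + t • v)) z * (1 - ρ * t) ^ 2)) zero_le_one
    (fun t ht => ((hq t ht).mul ((hl t).pow 2)).neg)
    (fun t ht => by
      have h1 : third f (x + t • v) v z z * (1 - ρ * t) ≤ 2 * ρ * quad (hess f (x + t • v)) z :=
        (mul_le_mul_of_nonneg_right (le_abs_self _) (hpos t ht).le).trans (hthird t ht)
      have h2 := hpos t ht
      have h3 := mul_le_mul_of_nonneg_right h1 h2.le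
      simp only [Pi.pow_apply, Nat.cast_ofNat, Nat.add_one_sub_one, pow_one]
      linarith)
  have lo := le_of_hasDerivAt_nonneg
    (f := fun t : ℝ => quad (hess f (x + t • v)) z * ((1 - ρ * t) ^ 2)⁻¹) zero_le_one
    (fun t ht => (hq t ht).mul (((hl t).pow 2).inv (pow_ne_zero 2 (hpos t ht).ne')))
    (fun t ht => by
      have h1 : -(2 * ρ * quad (hess f (x + t • v)) z) ≤
          third f (x + t • v) v z z * (1 - ρ * t) := by
        have := mul_le_mul_of_nonneg_right (neg_abs_le (third f (x + t • v) v z z)) (hpos t ht).le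
        linarith [hthird t ht]
      have h2 := hpos t ht
      simp only [Pi.pow_apply, Nat.cast_ofNat, Nat.add_one_sub_one, pow_one]
      have : third f (x + t • v) v z z * ((1 - ρ * t) ^ 2)⁻¹ +
          quad (hess f (x + t • v)) z * (-(2 * (1 - ρ * t) * -ρ) / ((1 - ρ * t) ^ 2) ^ 2)
          = (third f (x + t • v) v z z * (1 - ρ * t) + 2 * ρ * quad (hess f (x + t • v)) z)
            / (1 - ρ * t) ^ 3 := by
        field_simp
      rw [this]
      exact div_nonneg (by linarith) (by positivity))
  rw [hxy] at up lo
  have h1ρ : 0 < (1 - ρ) ^ 2 := pow_pos (by linarith) 2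
  simp only [zero_smul, add_zero, mul_zero, sub_zero, one_pow, mul_one, inv_one] at up lo
  refine ⟨by linarith, ?_⟩
  rwa [← div_eq_mul_inv, le_div_iff₀ h1ρ, mul_comm] at lo

lemma inner_gradient_line_mono (hf : IsSelfConcordant K f M) {a b : ℝ} (hab : a ≤ b)
    (hin : ∀ t ∈ Set.Icc a b, x + t • v ∈ interior K) :
    inner ℝ (gradient f (x + a • v)) v ≤ inner ℝ (gradient f (x + b • v)) v :=
  le_of_hasDerivAt_nonneg (f := fun t : ℝ => inner ℝ (gradient f (x + t • v)) v) hab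
    (fun t ht => hasDerivAt_inner_gradient_line (hf.contDiffAt (hin t ht)))
    (fun t ht => hf.quad_nonneg (hin t ht) v)

/-- A self-concordant function on a compact set, plus a linear function, attains its minimum, and
the gradient vanishes there. -/
lemma exists_gradient_eq_neg (hf : IsSelfConcordant K f M) (hK : IsCompact K)
    (hne : (interior K).Nonempty) (s : Vec d) :
    ∃ w ∈ interior K, gradient f w = -s ∧ ∀ y ∈ interior K,
      f w + inner ℝ s w ≤ f y + inner ℝ s y := by
  obtain ⟨x₀, hx₀⟩ := hne
  set F : Vec d → ℝ := fun y => f y + inner ℝ s y with hF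
  have hcont : ContinuousOn F (interior K) := hf.contDiffOn.continuousOn.add (by fun_prop)
  set S : Set (Vec d) := {y | y ∈ interior K ∧ F y ≤ F x₀} with hS
  obtain ⟨C, hC⟩ := hK.isBounded.exists_norm_le
  have hlow : ∀ y ∈ interior K, -(‖s‖ * C) ≤ inner ℝ s y := fun y hy => by
    have h1 := (abs_le.1 (abs_real_inner_le_norm s y)).1
    have h2 := mul_le_mul_of_nonneg_left (hC y (interior_subset hy)) (norm_nonneg s)
    linarith
  -- A limit of the sublevel set cannot lie on the frontier: `f` tends to infinity there while the
  -- linear term is bounded on `K`.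
  have hclosed : IsClosed S := by
    refine isClosed_of_closure_subset fun y hy => ?_
    have hyK : y ∈ K := hK.isClosed.closure_subset_iff.2
      (fun z hz => interior_subset hz.1) hy
    have hfreq : ∃ᶠ z in 𝓝 y, z ∈ S := mem_closure_iff_frequently.1 hy
    by_cases hyi : y ∈ interior K
    · refine ⟨hyi, ?_⟩
      by_contra hlt
      have hev := (hcont.continuousAt (isOpen_interior.mem_nhds hyi)).eventually_const_lt
        (not_le.1 hlt)
      obtain ⟨z, hz1, hz2⟩ := (hfreq.and_eventually hev).exists
      exact absurd hz1.2 (not_le.2 hz2)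
    · have hfr : y ∈ frontier K := ⟨subset_closure hyK, hyi⟩
      have hev := (hf.tendsto_frontier y hfr).eventually_gt_atTop (F x₀ + ‖s‖ * C)
      rw [eventually_nhdsWithin_iff] at hev
      obtain ⟨z, hz1, hz2⟩ := (hfreq.and_eventually hev).exists
      have h3 := hz2 hz1.1
      have h4 := hlow z hz1.1
      have h5 : f z + inner ℝ s z ≤ F x₀ := hz1.2
      linarith
  have hcomp : IsCompact S := hK.of_isClosed_subset hclosed fun z hz => interior_subset hz.1
  obtain ⟨w, hw, hmin⟩ := hcomp.exists_isMinOn ⟨x₀, hx₀, le_rfl⟩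
    (hcont.mono fun z hz => hz.1)
  have hmin' : ∀ y ∈ interior K, F w ≤ F y := fun y hy => by
    by_cases h : F y ≤ F x₀
    · exact hmin ⟨hy, h⟩
    · exact hw.2.trans (not_le.1 h).le
  refine ⟨w, hw.1, ?_, hmin'⟩
  have hloc : IsLocalMin F w :=
    Filter.mem_of_superset (isOpen_interior.mem_nhds hw.1) hmin'
  have hd : HasFDerivAt F (fderiv ℝ f w + innerCLM d s) w :=
    (((hf.contDiffAt hw.1).differentiableAt (by norm_num)).hasFDerivAt).add
      (innerCLM d s).hasFDerivAt
  have h0 := hloc.hasFDerivAt_eq_zero hd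
  refine ext_inner_right ℝ fun z => ?_
  have h1 := congrArg (fun L => L z) h0
  simp only [add_apply, innerCLM_apply, zero_apply] at h1
  rw [inner_gradient, inner_neg_left]
  linarith

end IsSelfConcordant

/-! ### Consequences of the barrier parameter -/

namespace IsSelfConcordantBarrier

variable {Ψ : Vec d → ℝ}

/-- Cauchy–Schwarz for dual norms replaces the inverse Hessian by a bound usable along lines. -/
lemma inner_gradient_sq_le (h : IsSelfConcordantBarrier K Ψ M ν) (hb : Bornology.IsBounded K)
    (hx : x ∈ interior K) (v : Vec d) :
    inner ℝ (gradient Ψ x) v ^ 2 ≤ ν * quad (hess Ψ x) v := by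
  have hf := h.toIsSelfConcordant
  have h1 := abs_inner_le_dual (hf.isSymm hx) (fun v hv => hf.quad_pos hb hx hv) (gradient Ψ x) v
  have h2 : matNorm (hess Ψ x)⁻¹ (gradient Ψ x) ≤ Real.sqrt ν :=
    Real.sqrt_le_sqrt (h.gradient_le x hx)
  have h3 := h1.trans (mul_le_mul_of_nonneg_right h2 (matNorm_nonneg _ _))
  have h4 := pow_le_pow_left₀ (abs_nonneg _) h3 2
  rwa [sq_abs, mul_pow, Real.sq_sqrt h.param_nonneg, matNorm_sq (hf.quad_nonneg hx v)] at h4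

/-- The parameter of a self-concordant barrier is at least `1 / M²`. -/
lemma one_le_mul_sqrt (h : IsSelfConcordantBarrier K Ψ M ν) (hb : Bornology.IsBounded K)
    (hx : x ∈ interior K) (hv : v ≠ 0) : 1 ≤ M * Real.sqrt ν := by
  have hf := h.toIsSelfConcordant
  by_contra hlt
  rw [not_le] at hlt
  obtain ⟨T, hT, hout⟩ := exists_not_mem_of_isBounded (x := x) hb hv
  obtain ⟨s, hs, hfr, hin⟩ := exists_exit hx hT hout
  set p : ℝ → ℝ := fun t => inner ℝ (gradient Ψ (x + t • v)) v with hp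
  set q : ℝ → ℝ := fun t => quad (hess Ψ (x + t • v)) v with hq
  have hφ : ∀ t ∈ Set.Ico 0 s, HasDerivAt (fun t : ℝ => Ψ (x + t • v)) (p t) t := fun t ht =>
    hasDerivAt_line (hf.contDiffAt (hin t ht))
  have hp' : ∀ t ∈ Set.Ico 0 s, HasDerivAt p (q t) t := fun t ht =>
    hasDerivAt_inner_gradient_line (hf.contDiffAt (hin t ht))
  have hq' : ∀ t ∈ Set.Ico 0 s, HasDerivAt q (third Ψ (x + t • v) v v v) t := fun t ht =>
    hasDerivAt_quad_hess_line (hf.contDiffAt (hin t ht))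
  have hqpos : ∀ t ∈ Set.Ico 0 s, 0 < q t := fun t ht => hf.quad_pos hb (hin t ht) hv
  have hpq : ∀ t ∈ Set.Ico 0 s, p t ^ 2 ≤ ν * q t := fun t ht =>
    h.inner_gradient_sq_le hb (hin t ht) v
  -- The slope must become positive before the exit, since otherwise `Ψ` could not blow up; by
  -- monotonicity it stays positive.
  obtain ⟨a, ha, hpa⟩ : ∃ a ∈ Set.Ico 0 s, 0 < p a := by
    by_contra hno
    push Not at hno
    refine hf.not_bounded_to_exit (x := x) (v := v) hs hfr hin (Ψ x) fun t ht => ?_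
    have := sub_le_sub_of_hasDerivAt_le (g := fun _ => (0 : ℝ)) (g' := fun _ => 0) ht.1
      (fun r hr => hφ r ⟨hr.1, hr.2.trans_lt ht.2⟩) (fun r _ => hasDerivAt_const r 0)
      (fun r hr => hno r ⟨hr.1, hr.2.trans_lt ht.2⟩)
    simp only [zero_smul, add_zero] at this
    linarith
  have hc : 0 < 2 * (1 - M * Real.sqrt ν) := by linarith
  -- Since `p' = q` and `p ≤ √ν √q`, the quotient `p ^ 2 / q ≤ ν` has derivative at least `2 (1 - M
  -- √ν) p`, a multiple of the derivative of `Ψ`. If `M √ν < 1`, this bounds `Ψ` up to the exit.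
  have hbound : ∀ t ∈ Set.Ico a s,
      2 * (1 - M * Real.sqrt ν) * (Ψ (x + t • v) - Ψ (x + a • v)) ≤ ν := by
    intro t ht
    have hsub : ∀ r ∈ Set.Icc a t, r ∈ Set.Ico 0 s := fun r hr =>
      ⟨ha.1.trans hr.1, hr.2.trans_lt ht.2⟩
    have key := sub_le_sub_of_hasDerivAt_le
      (f := fun r : ℝ => 2 * (1 - M * Real.sqrt ν) * Ψ (x + r • v))
      (g := fun r => p r ^ 2 / q r) ht.1
      (fun r hr => (hφ r (hsub r hr)).const_mul _)
      (fun r hr => ((hp' r (hsub r hr)).pow 2).div (hq' r (hsub r hr)) (hqpos r (hsub r hr)).ne')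
      (fun r hr => by
        have hr0 := hsub r hr
        have hqr := hqpos r hr0
        have hpr : 0 < p r := hpa.trans_le (hf.inner_gradient_line_mono hr.1
          fun y hy => hin y (hsub y ⟨hy.1, hy.2.trans hr.2⟩))
        have h3 := (abs_le.1 (hf.abs_third_diag_le (hin r hr0) v)).2
        set N := matNorm (hess Ψ (x + r • v)) v with hN
        have hNpos : 0 < N := Real.sqrt_pos.2 hqr
        have hNq : q r = N ^ 2 := (matNorm_sq hqr.le).symm
        have hpN : p r ≤ Real.sqrt ν * N := by
          have := Real.le_sqrt_of_sq_le (hpq r hr0)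
          rwa [Real.sqrt_mul h.param_nonneg] at this
        simp only [Pi.pow_apply, Nat.cast_ofNat, Nat.add_one_sub_one, pow_one]
        rw [hNq, le_div_iff₀ (by positivity)]
        have h4 : p r ^ 2 * third Ψ (x + r • v) v v v ≤ p r ^ 2 * (2 * M * N ^ 3) :=
          mul_le_mul_of_nonneg_left h3 (sq_nonneg _)
        have h5 : p r * (p r * (2 * M * N ^ 3)) ≤ (Real.sqrt ν * N) * (p r * (2 * M * N ^ 3)) :=
          mul_le_mul_of_nonneg_right hpN
            (mul_nonneg hpr.le (mul_nonneg (mul_nonneg zero_le_two hf.const_nonneg)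
              (pow_nonneg hNpos.le 3)))
        linarith)
    have ht0 := hsub t ⟨ht.1, le_rfl⟩
    have e1 : p t ^ 2 / q t ≤ ν := (div_le_iff₀ (hqpos t ht0)).2 (hpq t ht0)
    have e2 : 0 ≤ p a ^ 2 / q a := div_nonneg (sq_nonneg _) (hqpos a ha).le
    linarith
  have hbound2 : ∀ t ∈ Set.Icc 0 a, Ψ (x + t • v) ≤ Ψ x + |p a| * a := by
    intro t ht
    have := sub_le_sub_of_hasDerivAt_le (g := fun r => p a * r) (g' := fun _ => p a) ht.1
      (fun r hr => hφ r ⟨hr.1, (hr.2.trans ht.2).trans_lt ha.2⟩)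
      (fun r _ => by simpa using (hasDerivAt_id r).const_mul (p a))
      (fun r hr => hf.inner_gradient_line_mono (hr.2.trans ht.2)
        fun y hy => hin y ⟨hr.1.trans hy.1, hy.2.trans_lt ha.2⟩)
    simp only [zero_smul, add_zero, mul_zero, sub_zero] at this
    have h2 : p a * t ≤ |p a| * a :=
      mul_le_mul (le_abs_self _) ht.2 ht.1 (abs_nonneg _)
    linarith
  refine hf.not_bounded_to_exit (x := x) (v := v) hs hfr hin
    (Ψ x + |p a| * a + ν / (2 * (1 - M * Real.sqrt ν))) fun t ht => ?_
  have hν : 0 ≤ ν / (2 * (1 - M * Real.sqrt ν)) := div_nonneg h.param_nonneg hc.le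
  rcases le_total t a with hta | hta
  · linarith [hbound2 t ⟨ht.1, hta⟩]
  · have e1 := hbound t ⟨hta, ht.2⟩
    rw [mul_comm, ← le_div_iff₀ hc] at e1
    linarith [hbound2 a ⟨ha.1, le_rfl⟩]

/-- The slope satisfies `p' ≥ p ^ 2 / ν`, so where positive its reciprocal falls at rate at least `1
/ ν`. The reciprocal is still positive at time 1, as `y` is interior; hence `1 - s ≤ ν / p s`. -/
lemma inner_gradient_line_le (h : IsSelfConcordantBarrier K Ψ M ν) (hb : Bornology.IsBounded K)
    (hK : Convex ℝ K) (hx : x ∈ interior K) (hy : y ∈ interior K) {s : ℝ}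
    (hs : s ∈ Set.Ico (0 : ℝ) 1) :
    inner ℝ (gradient Ψ (x + s • (y - x))) (y - x) ≤ ν / (1 - s) := by
  have hf := h.toIsSelfConcordant
  set v := y - x with hv
  have hin : ∀ t ∈ Set.Icc s 1, x + t • v ∈ interior K := fun t ht =>
    IsSelfConcordant.segment_mem hK hx hy ⟨hs.1.trans ht.1, ht.2⟩
  have h1s : 0 < 1 - s := sub_pos.2 hs.2
  set p : ℝ → ℝ := fun t => inner ℝ (gradient Ψ (x + t • v)) v with hp
  change p s ≤ _
  by_cases hps : p s ≤ 0
  · exact hps.trans (div_nonneg h.param_nonneg h1s.le)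
  rw [not_le] at hps
  have hpos : ∀ t ∈ Set.Icc s 1, 0 < p t := fun t ht =>
    hps.trans_le (hf.inner_gradient_line_mono ht.1 fun r hr => hin r ⟨hr.1, hr.2.trans ht.2⟩)
  have key := sub_le_sub_of_hasDerivAt_le (f := fun t : ℝ => t) (f' := fun _ => 1)
    (g := fun t => ν * -(p t)⁻¹) hs.2.le (fun t _ => hasDerivAt_id t)
    (fun t ht => (((hasDerivAt_inner_gradient_line (z := v) (hf.contDiffAt (hin t ht))).inv
      (hpos t ht).ne').neg).const_mul ν)
    (fun t ht => by
      have h2 := h.inner_gradient_sq_le hb (hin t ht) v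
      have h3 : 0 < inner ℝ (gradient Ψ (x + t • v)) v ^ 2 := pow_pos (hpos t ht) 2
      rw [neg_div, neg_neg, ← mul_div_assoc, le_div_iff₀ h3, one_mul]
      exact h2)
  have h1 : 0 < (p 1)⁻¹ := inv_pos.2 (hpos 1 ⟨hs.2.le, le_rfl⟩)
  have h2 := mul_nonneg h.param_nonneg h1.le
  have h3 : 1 - s ≤ ν * (p s)⁻¹ := by linarith
  rw [← div_eq_mul_inv, le_div_iff₀ hps] at h3
  rw [le_div_iff₀ h1s]
  linarith

/-- The logarithmic growth of a self-concordant barrier along segments. -/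
lemma line_sub_le (h : IsSelfConcordantBarrier K Ψ M ν) (hb : Bornology.IsBounded K)
    (hK : Convex ℝ K) (hx : x ∈ interior K) (hy : y ∈ interior K) {s : ℝ}
    (hs : s ∈ Set.Ico (0 : ℝ) 1) :
    Ψ (x + s • (y - x)) - Ψ x ≤ -(ν * Real.log (1 - s)) := by
  have hf := h.toIsSelfConcordant
  have := sub_le_sub_of_hasDerivAt_le (f := fun t : ℝ => Ψ (x + t • (y - x)))
    (g := fun t => -(ν * Real.log (1 - t))) (g' := fun t => ν / (1 - t)) hs.1
    (fun t ht => hasDerivAt_line (hf.contDiffAt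
      (IsSelfConcordant.segment_mem hK hx hy ⟨ht.1, ht.2.trans hs.2.le⟩)))
    (fun t ht => by
      have hne : 1 - t ≠ 0 := (sub_pos.2 (ht.2.trans_lt hs.2)).ne'
      refine ((((hasDerivAt_id t).const_sub 1).log hne).const_mul ν).neg.congr_deriv ?_
      simp only [id]
      ring)
    (fun t ht => h.inner_gradient_line_le hb hK hx hy ⟨ht.1, ht.2.trans_lt hs.2⟩)
  simpa using this

end IsSelfConcordantBarrier

end Barons

namespace Barons

variable {d : ℕ} {K : Set (Vec d)} {f Ψ : Vec d → ℝ} {M ν R : ℝ} {x v y z : Vec d}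

/-! ### The regularized barrier is self-concordant -/

/-- The quadratic term has no third derivative and only enlarges the local norm, so the constant `M`
is kept. -/
lemma isSelfConcordant_regBarrier (h : IsSelfConcordant K Ψ M) (hν : 0 ≤ ν) :
    IsSelfConcordant K (regBarrier Ψ ν R) M where
  const_nonneg := h.const_nonneg
  convexOn := by
    have hn : ConvexOn ℝ (interior K) fun w : Vec d => ‖w‖ ^ 2 :=
      ((convexOn_norm convex_univ).pow (fun _ _ => norm_nonneg _) 2).subset
        (Set.subset_univ _) h.convexOn.1
    exact h.convexOn.add (hn.smul (by positivity))
  contDiffOn := fun x hx => (contDiffAt_regBarrier (h.contDiffAt hx)).contDiffWithinAt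
  tendsto_frontier := fun x hx => tendsto_atTop_mono
    (fun w => le_add_of_nonneg_right (by positivity)) (h.tendsto_frontier x hx)
  third_le := fun x hx u => by
    rw [iteratedFDeriv_three_apply, third_regBarrier (h.contDiffAt hx)]
    refine (h.abs_third_diag_le hx u).trans ?_
    have hM := h.const_nonneg
    have : matNorm (hess Ψ x) u ≤ matNorm (hess (regBarrier Ψ ν R) x) u := by
      refine Real.sqrt_le_sqrt ?_
      rw [quad_hess_regBarrier (h.contDiffAt hx)]
      exact le_add_of_nonneg_right (by positivity)
    have h0 := matNorm_nonneg (hess Ψ x) u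
    gcongr

lemma matNorm_hess_le_regBarrier (h : IsSelfConcordant K Ψ M) (hν : 0 ≤ ν) (hx : x ∈ interior K)
    (v : Vec d) : matNorm (hess Ψ x) v ≤ matNorm (hess (regBarrier Ψ ν R) x) v := by
  refine Real.sqrt_le_sqrt ?_
  rw [quad_hess_regBarrier (h.contDiffAt hx)]
  exact le_add_of_nonneg_right (by positivity)

/-- This is what the quadratic term is for: Euclidean bounds on subgradients become dual bounds in
the local norm, and local distances become Euclidean ones. -/
lemma sqrt_mul_norm_le (h : IsSelfConcordant K Ψ M) (hν : 0 ≤ ν) (hR : 0 < R)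
    (hx : x ∈ interior K) (v : Vec d) :
    Real.sqrt ν * ‖v‖ ≤ R * matNorm (hess (regBarrier Ψ ν R) x) v := by
  rw [← div_le_iff₀' hR]
  refine Real.le_sqrt_of_sq_le ?_
  rw [quad_hess_regBarrier (h.contDiffAt hx), div_pow, mul_pow, Real.sq_sqrt hν]
  have := h.quad_nonneg hx v
  rw [mul_div_right_comm]
  linarith

/-! ### One Newton step with an inexact gradient and a fixed matrix -/

/-- Let `z` be the error after the step, `v` the error before. The increment of the gradient from
`wmin` to `w` is an averaged Hessian applied to `v`, which differs from `H v` by a relative `κ`.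
Pairing with `z` gives `‖z‖² ≤ ‖z‖ (κ ‖v‖ + (1 + κ) ε)` in the norm of `H`. -/
lemma newton_step_contracts (hf : IsSelfConcordant K f M) (hK : Convex ℝ K) {H : Mat d}
    (hH : H.IsSymm) (hH0 : ∀ z, z ≠ 0 → 0 < quad H z) {κ ε : ℝ} (hκ : 0 ≤ κ) (hε : 0 ≤ ε)
    {w wmin s p : Vec d} (hw : w ∈ interior K) (hmin : wmin ∈ interior K)
    (hgrad : gradient f wmin = -s)
    (hclose : ∀ t ∈ Set.Icc (0 : ℝ) 1, ∀ z,
      |quad (hess f (wmin + t • (w - wmin))) z - quad H z| ≤ κ * quad H z)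
    (hp : ∀ z, |inner ℝ (p - gradient f w) z| ≤ ε * matNorm (hess f w) z) :
    matNorm H (w - WithLp.toLp 2 (H⁻¹.mulVec (p + s).ofLp) - wmin)
      ≤ κ * matNorm H (w - wmin) + (1 + κ) * ε := by
  have hH1 := quad_nonneg_of_pos hH0
  set v := w - wmin with hv
  set z := w - WithLp.toLp 2 (H⁻¹.mulVec (p + s).ofLp) - wmin with hz
  have hin : ∀ t ∈ Set.Icc (0 : ℝ) 1, wmin + t • v ∈ interior K := fun t ht =>
    IsSelfConcordant.segment_mem hK hmin hw ht
  have hmv := sub_le_sub_of_hasDerivAt_le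
    (f := fun t : ℝ => bil H v z * t - inner ℝ (gradient f (wmin + t • v)) z)
    (g := fun t => κ * (matNorm H v * matNorm H z) * t)
    (g' := fun _ => κ * (matNorm H v * matNorm H z)) zero_le_one
    (fun t ht => (((hasDerivAt_id t).const_mul (bil H v z))).sub
      (hasDerivAt_inner_gradient_line (hf.contDiffAt (hin t ht))))
    (fun t _ => by simpa using (hasDerivAt_id t).const_mul (κ * (matNorm H v * matNorm H z)))
    (fun t ht => by
      have h1 := abs_bil_le_of_abs_quad_le (S := hess f (wmin + t • v) - H)
        ((hf.isSymm (hin t ht)).sub hH) hH hH1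
        (fun z => by rw [quad_eq_bil, bil_matrix_sub]; exact hclose t ht z) v z
      rw [abs_of_nonneg hκ, bil_matrix_sub] at h1
      linarith [(abs_le.1 h1).1])
  have hone : wmin + (1 : ℝ) • v = w := by simp [hv]
  simp only [hone, zero_smul, add_zero, mul_one, mul_zero, sub_zero, zero_sub] at hmv
  have hquad : quad H z = bil H v z - inner ℝ (p + s) z := by
    rw [← bil_inv_mulVec hH (isUnit_det_of_quad_pos hH0), ← bil_sub_left, quad_eq_bil]
    congr 1
    rw [hz, hv]; abel
  have hps : inner ℝ (p + s) z = inner ℝ (p - gradient f w) z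
      + (inner ℝ (gradient f w) z - inner ℝ (gradient f wmin) z) := by
    rw [hgrad, inner_neg_left, inner_sub_left, inner_add_left]; ring
  have herr := (abs_le.1 (hp z)).1
  have hNw : matNorm (hess f w) z ≤ (1 + κ) * matNorm H z := by
    refine matNorm_le_of_quad_le (by linarith) ?_
    have h1 := hclose 1 ⟨zero_le_one, le_rfl⟩ z
    rw [hone] at h1
    have h2 := (abs_le.1 h1).2
    have h3 := mul_nonneg hκ (hH1 z)
    have h4 := mul_nonneg hκ h3
    nlinarith
  have hNw' := mul_le_mul_of_nonneg_left hNw hε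
  have hsq := matNorm_sq (hH1 z)
  have hfin : matNorm H z * matNorm H z
      ≤ matNorm H z * (κ * matNorm H v + (1 + κ) * ε) := by nlinarith
  rcases (matNorm_nonneg H z).eq_or_lt with h | h
  · rw [← h]
    have := matNorm_nonneg H v
    positivity
  · exact le_of_mul_le_mul_left hfin h

/-! ### Landmarks -/

/-- `H` is a `1 ± 0.001` approximation of the Hessian of `f` at the point `u` of `int K`. -/
structure IsLandmark (K : Set (Vec d)) (f : Vec d → ℝ) (u : Vec d) (H : Mat d) : Prop where
  mem : u ∈ interior K
  isSymm : H.IsSymm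
  lower : ∀ z, 0.999 * quad (hess f u) z ≤ quad H z
  upper : ∀ z, quad H z ≤ 1.001 * quad (hess f u) z

namespace IsLandmark

variable {u : Vec d} {H : Mat d}

lemma quad_pos (hL : IsLandmark K f u H) (hf : IsSelfConcordant K f M)
    (hb : Bornology.IsBounded K) (hz : z ≠ 0) : 0 < quad H z := by
  have := hf.quad_pos hb hL.mem hz
  exact lt_of_lt_of_le (by linarith) (hL.lower z)

lemma quad_nonneg (hL : IsLandmark K f u H) (hf : IsSelfConcordant K f M)
    (hb : Bornology.IsBounded K) (z : Vec d) : 0 ≤ quad H z :=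
  quad_nonneg_of_pos (fun _ hz => hL.quad_pos hf hb hz) z

lemma matNorm_hess_le (hL : IsLandmark K f u H) (hf : IsSelfConcordant K f M)
    (hb : Bornology.IsBounded K) (z : Vec d) : matNorm (hess f u) z ≤ 1.001 * matNorm H z := by
  refine matNorm_le_of_quad_le (by norm_num) ?_
  have := hL.lower z
  have := hL.quad_nonneg hf hb z
  linarith

lemma mem_of_close (hL : IsLandmark K f u H) (hf : IsSelfConcordant K f M)
    (hb : Bornology.IsBounded K) (hy : M * matNorm H (y - u) ≤ 0.03) : y ∈ interior K := by
  have h1 := mul_le_mul_of_nonneg_left (hL.matNorm_hess_le hf hb (y - u)) hf.const_nonneg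
  have := hf.dikin_mem (v := y - u) hb hL.mem (by linarith)
  simpa using this

lemma abs_quad_sub_le (hL : IsLandmark K f u H) (hf : IsSelfConcordant K f M)
    (hb : Bornology.IsBounded K) (hK : Convex ℝ K) (hy : M * matNorm H (y - u) ≤ 0.03)
    (z : Vec d) : |quad (hess f y) z - quad H z| ≤ 0.1 * quad H z := by
  have h1 := mul_le_mul_of_nonneg_left (hL.matNorm_hess_le hf hb (y - u)) hf.const_nonneg
  -- `5 / 4 · 1.001 · 0.03 ≤ 0.038`. The resulting factors `0.962 ^ (±2)`, together with the
  -- landmark accuracy `0.001`, stay within `1 ± 0.1`.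
  obtain ⟨h2, h3⟩ := hf.quad_hess_compare hb hK hL.mem (hL.mem_of_close hf hb hy)
    (ρ := 0.038) (by linarith) (by norm_num) z
  have h4 := hL.lower z
  have h5 := hL.upper z
  have h6 := hL.quad_nonneg hf hb z
  norm_num at h2 h3 h4 h5
  rw [abs_le]
  constructor <;> linarith

lemma matNorm_le_hess (hL : IsLandmark K f u H) (hf : IsSelfConcordant K f M)
    (hb : Bornology.IsBounded K) (hK : Convex ℝ K) (hy : M * matNorm H (y - u) ≤ 0.03)
    (z : Vec d) : matNorm H z ≤ 1.06 * matNorm (hess f y) z := by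
  refine matNorm_le_of_quad_le (by norm_num) ?_
  have h1 := (abs_le.1 (hL.abs_quad_sub_le hf hb hK hy z)).1
  have h2 := hL.quad_nonneg hf hb z
  linarith

/-- The matrices of two nearby landmarks are comparable. -/
lemma matNorm_le (hL : IsLandmark K f u H) (hf : IsSelfConcordant K f M)
    (hb : Bornology.IsBounded K) (hK : Convex ℝ K) {u' : Vec d} {H' : Mat d}
    (hL' : IsLandmark K f u' H') (hy : M * matNorm H (u' - u) ≤ 0.03) (z : Vec d) :
    matNorm H' z ≤ 1.06 * matNorm H z := by
  refine matNorm_le_of_quad_le (by norm_num) ?_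
  have h1 := (abs_le.1 (hL.abs_quad_sub_le hf hb hK hy z)).2
  have h2 := hL.quad_nonneg hf hb z
  have h3 := hL'.upper z
  linarith

lemma triangle (hL : IsLandmark K f u H) (hf : IsSelfConcordant K f M)
    (hb : Bornology.IsBounded K) (a b c : Vec d) :
    matNorm H (a - c) ≤ matNorm H (a - b) + matNorm H (b - c) :=
  matNorm_sub_le hL.isSymm (hL.quad_nonneg hf hb) a b c

/-- One step towards the minimizer `wmin`, near a landmark. -/
lemma newton_step (hL : IsLandmark K f u H) (hf : IsSelfConcordant K f M)
    (hb : Bornology.IsBounded K) (hK : Convex ℝ K) {ε : ℝ} (hε : 0 ≤ ε)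
    (hεM : M * ε ≤ 1 / 20000) {w wmin s p : Vec d} (hw : w ∈ interior K)
    (hmin : wmin ∈ interior K) (hgrad : gradient f wmin = -s)
    (hmu : M * matNorm H (wmin - u) ≤ 0.027) (hwm : M * matNorm H (w - wmin) ≤ 0.0025)
    (hp : ∀ z, |inner ℝ (p - gradient f w) z| ≤ ε * matNorm (hess f w) z) :
    w - WithLp.toLp 2 (H⁻¹.mulVec (p + s).ofLp) ∈ interior K ∧
    matNorm H (w - WithLp.toLp 2 (H⁻¹.mulVec (p + s).ofLp) - wmin)
      ≤ 0.1 * matNorm H (w - wmin) + 1.1 * ε := by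
  have hM := hf.const_nonneg
  have hstep := newton_step_contracts hf hK hL.isSymm (fun z hz => hL.quad_pos hf hb hz)
    -- The whole segment from `wmin` to `w` lies within `0.027 + 0.0025 ≤ 0.03` of the landmark, in
    -- units of `1 / M`.
    (κ := 0.1) (by norm_num) hε hw hmin hgrad (fun t ht z => by
      refine hL.abs_quad_sub_le hf hb hK ?_ z
      have h1 := hL.triangle hf hb (wmin + t • (w - wmin)) wmin u
      rw [add_sub_cancel_left, matNorm_smul, abs_of_nonneg ht.1] at h1
      have h2 : t * matNorm H (w - wmin) ≤ matNorm H (w - wmin) :=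
        mul_le_of_le_one_left (matNorm_nonneg _ _) ht.2
      have h3 := mul_le_mul_of_nonneg_left (h1.trans (add_le_add_left h2 _)) hM
      linarith) hp
  have hstep' : matNorm H (w - WithLp.toLp 2 (H⁻¹.mulVec (p + s).ofLp) - wmin)
      ≤ 0.1 * matNorm H (w - wmin) + 1.1 * ε := by linarith
  refine ⟨hL.mem_of_close hf hb ?_, hstep'⟩
  have h1 := hL.triangle hf hb (w - WithLp.toLp 2 (H⁻¹.mulVec (p + s).ofLp)) wmin u
  have h2 := mul_le_mul_of_nonneg_left (h1.trans (add_le_add_left hstep' _)) hM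
  linarith

end IsLandmark

/-! ### Stability of the minimizers -/

/-- If the linear term changes by a vector of dual norm at most `β`, then the minimizer moves by
at most `1.002 β`. -/
lemma matNorm_minimizer_sub_le (hf : IsSelfConcordant K f M) (hb : Bornology.IsBounded K)
    (hK : Convex ℝ K) {β : ℝ} (hβ : 0 ≤ β) (hβM : M * β ≤ 1 / 1000) {a b s e : Vec d}
    (ha : a ∈ interior K) (hb' : b ∈ interior K) (hga : gradient f a = -s)
    (hgb : gradient f b = -(s + e))
    (he : |inner ℝ e (b - a)| ≤ β * matNorm (hess f a) (b - a)) :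
    matNorm (hess f a) (b - a) ≤ 1.002 * β := by
  have h1 := hf.inner_gradient_sub_ge hb hK ha hb'
  have h2 : gradient f b - gradient f a = -e := by rw [hga, hgb]; abel
  rw [h2, inner_neg_left] at h1
  set r := matNorm (hess f a) (b - a) with hr
  have r0 : 0 ≤ r := matNorm_nonneg _ _
  have hM := hf.const_nonneg
  have h3 := h1.trans ((neg_le_abs _).trans he)
  have hpos : 0 < 1 + M * r := by positivity
  rw [div_le_iff₀ hpos] at h3
  rcases r0.eq_or_lt with h | h
  · rw [← h]; positivity
  -- Since `M β ≤ 1 / 1000`, this gives `0.999 r ≤ β`.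
  · have h4 : r ≤ β * (1 + M * r) := by
      refine le_of_mul_le_mul_left ?_ h
      linarith
    have h5 := mul_le_mul_of_nonneg_right hβM r0
    linarith

end Barons

namespace Barons

variable {d : ℕ}

/-! ### Values and operation counts of the elementary routines -/

section Routines

@[simp] lemma bind_val {α β : Type} (x : Comp α) (f : α → Comp β) :
    (x >>= f).val = (f x.val).val := rfl

@[simp] lemma bind_ops {α β : Type} (x : Comp α) (f : α → Comp β) :
    (x >>= f).ops = x.ops + (f x.val).ops := rfl

@[simp] lemma pure_val {α : Type} (a : α) : (pure a : Comp α).val = a := rfl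

@[simp] lemma pure_ops {α : Type} (a : α) : (pure a : Comp α).ops = 0 := rfl

@[simp] lemma vadd_val (x y : Vec d) : (vadd x y).val = x + y := rfl

@[simp] lemma vsub_val (x y : Vec d) : (vsub x y).val = x - y := rfl

@[simp] lemma vsmul_val (a : ℝ) (x : Vec d) : (vsmul a x).val = a • x := rfl

@[simp] lemma normVia_val (A : Mat d) (x : Vec d) : (normVia A x).val = matNorm A x := rfl

@[simp] lemma rle_val (x y : ℝ) : (rle x y).val = decide (x ≤ y) := rfl

@[simp] lemma vadd_ops (x y : Vec d) : (vadd x y).ops = d • tick Op.arith := by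
  simp [vadd, forEach, radd]

@[simp] lemma vsub_ops (x y : Vec d) : (vsub x y).ops = d • tick Op.arith := by
  simp [vsub, forEach, rsub]

@[simp] lemma vsmul_ops (a : ℝ) (x : Vec d) : (vsmul a x).ops = d • tick Op.arith := by
  simp [vsmul, forEach, rmul]

@[simp] lemma vdot_ops (x y : Vec d) : (vdot x y).ops = (2 * d) • tick Op.arith := by
  simp [vdot, accumulate, rmul, ← two_nsmul]
  ring

@[simp] lemma matVec_ops (A : Mat d) (x : Vec d) :
    (matVec A x).ops = (2 * d ^ 2) • tick Op.arith := by
  simp only [matVec, forEach, accumulate, rmul, ← two_nsmul, Finset.sum_const, Finset.card_univ,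
    Fintype.card_fin, ← mul_nsmul]
  congr 1; ring

@[simp] lemma normVia_ops (A : Mat d) (x : Vec d) :
    (normVia A x).ops = (2 * d ^ 2 + 2 * d + 1) • tick Op.arith := by
  simp only [normVia, bind_ops, matVec_ops, vdot_ops, rsqrt]
  simp only [add_nsmul, one_nsmul]
  abel

@[simp] lemma rle_ops (x y : ℝ) : (rle x y).ops = tick Op.arith := rfl

lemma regGrad_val (O : Vec d → Vec d) (a : ℝ) (w : Vec d) :
    (regGrad O a w).val = O w + a • w := rfl

lemma regGrad_ops (O : Vec d → Vec d) (a : ℝ) (w : Vec d) :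
    (regGrad O a w).ops = tick Op.gradCall + (2 * d) • tick Op.arith := by
  simp only [regGrad, bind_ops, callGrad, vsmul_ops, vadd_ops, two_mul, add_nsmul]

lemma regHess_fst (O : Vec d → Mat d × Mat d) (a : ℝ) (w : Vec d) :
    (regHess O a w).val.1 = (O w).1 + a • 1 := by
  ext i j
  by_cases h : i = j <;> simp [regHess, callHess, addDiag, radd, h]

lemma regHess_ops (O : Vec d → Mat d × Mat d) (a : ℝ) (w : Vec d) :
    (regHess O a w).ops = tick Op.hessCall + d • tick Op.arith + tick Op.matInv := by
  simp [regHess, callHess, addDiag, radd, invert, add_assoc]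

lemma newtonSteps_ops {gradO : Vec d → Comp (Vec d)} {c : Tally} (hc : ∀ w, (gradO w).ops = c)
    (Hinv : Mat d) (s : Vec d) (n : ℕ) (w : Vec d) :
    (newtonSteps gradO Hinv s n w).ops = n • (c + (2 * d ^ 2 + 2 * d) • tick Op.arith) := by
  induction n generalizing w with
  | zero => simp [newtonSteps]
  | succ n ih =>
    simp only [newtonSteps, bind_ops, hc, vadd_ops, matVec_ops, vsub_ops, ih, add_nsmul, one_nsmul,
      two_mul]
    abel

end Routines

/-! ### One round -/

section Round

variable {gradO : Vec d → Comp (Vec d)} {hessO : Vec d → Comp (Mat d × Mat d)} {η M : ℝ} {m : ℕ}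

/-- The next iterate of BARONS. -/
def nextPoint (gradO : Vec d → Comp (Vec d)) (η : ℝ) (m : ℕ) (g : Vec d) (σ : Store d) : Vec d :=
  (newtonSteps gradO σ.Hinv (σ.s + η • g) (m - 1) σ.w).val

lemma oneRound_val (g : Vec d) (σ : Store d) :
    (oneRound gradO hessO η M m g σ).val =
      if matNorm σ.H (nextPoint gradO η m g σ - σ.u) ≤ 1 / (41 * M) then
        { w := nextPoint gradO η m g σ, u := σ.u, H := σ.H, Hinv := σ.Hinv, s := σ.s + η • g }
      else
        { w := nextPoint gradO η m g σ, u := nextPoint gradO η m g σ,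
          H := (hessO (nextPoint gradO η m g σ)).val.1,
          Hinv := (hessO (nextPoint gradO η m g σ)).val.2, s := σ.s + η • g } := by
  by_cases h : matNorm σ.H (nextPoint gradO η m g σ - σ.u) ≤ 1 / (41 * M)
  · rw [if_pos h]
    unfold nextPoint at h ⊢
    simp only [oneRound, bind_val, vsmul_val, vadd_val, vsub_val, normVia_val, rle_val, decide_eq_true h,
      if_true, pure_val]
  · rw [if_neg h]
    unfold nextPoint at h ⊢
    simp only [oneRound, bind_val, vsmul_val, vadd_val, vsub_val, normVia_val, rle_val, decide_eq_false h,
      Bool.false_eq_true, if_false, pure_val]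

lemma oneRound_ops {c c' : Tally} (hc : ∀ w, (gradO w).ops = c) (hc' : ∀ w, (hessO w).ops = c')
    (g : Vec d) (σ : Store d) :
    (oneRound gradO hessO η M m g σ).ops =
      (m - 1) • (c + (2 * d ^ 2 + 2 * d) • tick Op.arith)
        + (2 * d ^ 2 + 5 * d + 2) • tick Op.arith
        + if matNorm σ.H (nextPoint gradO η m g σ - σ.u) ≤ 1 / (41 * M) then 0 else c' := by
  -- Scaling `g`, updating `s`, subtracting `u`, the norm with its square root, and the comparison.
  have e : (2 * d ^ 2 + 5 * d + 2 : ℕ) = d + d + d + (2 * d ^ 2 + 2 * d + 1) + 1 := by ring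
  by_cases h : matNorm σ.H (nextPoint gradO η m g σ - σ.u) ≤ 1 / (41 * M)
  · rw [if_pos h]
    unfold nextPoint at h
    simp only [oneRound, bind_ops, vsmul_val, vadd_val, vsub_val, normVia_val, rle_val,
      decide_eq_true h, if_true, pure_ops, vsmul_ops, vadd_ops, vsub_ops, normVia_ops, rle_ops,
      newtonSteps_ops hc]
    rw [e]
    simp only [add_nsmul (tick Op.arith), one_nsmul]
    abel
  · rw [if_neg h]
    unfold nextPoint at h
    simp only [oneRound, bind_ops, vsmul_val, vadd_val, vsub_val, normVia_val, rle_val,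
      decide_eq_false h, Bool.false_eq_true, if_false, pure_ops, vsmul_ops, vadd_ops, vsub_ops,
      normVia_ops, rle_ops, newtonSteps_ops hc, hc']
    rw [e]
    simp only [add_nsmul (tick Op.arith), one_nsmul]
    abel

end Round

/-! ### The oracles for the regularized barrier -/

section Oracles

variable {K : Set (Vec d)} {Ψ f : Vec d → ℝ} {M ν R ε : ℝ}

lemma quad_matrix_smul (c : ℝ) (A : Mat d) (z : Vec d) : quad (c • A) z = c * quad A z :=
  bil_matrix_smul c A z z

lemma quad_add_smul_one (A : Mat d) (a : ℝ) (z : Vec d) :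
    quad (A + a • 1) z = quad A z + a * ‖z‖ ^ 2 := by
  rw [quad_eq_bil, bil_matrix_add, bil_matrix_smul, bil_one, real_inner_self_eq_norm_sq,
    quad_eq_bil]

/-- The exact shift `a • w` cancels in the error, and the local norm of `Φ` dominates that of `Ψ`,
so the tolerance is unchanged. The pairing form spares the inverse Hessian of `Φ`. -/
lemma abs_inner_regGrad_sub_le (h : IsSelfConcordant K Ψ M) (hb : Bornology.IsBounded K)
    (hν : 0 ≤ ν) (hε : 0 ≤ ε) {O : Vec d → Vec d} (hO : IsGradientOracle K Ψ ε O) {w : Vec d}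
    (hw : w ∈ interior K) (z : Vec d) :
    |inner ℝ ((regGrad O (ν / R ^ 2) w).val - gradient (regBarrier Ψ ν R) w) z|
      ≤ ε * matNorm (hess (regBarrier Ψ ν R) w) z := by
  rw [regGrad_val, gradient_regBarrier (h.contDiffAt hw), add_sub_add_right_eq_sub]
  refine (abs_inner_le_dual (h.isSymm hw) (fun v hv => h.quad_pos hb hw hv) _ z).trans ?_
  exact mul_le_mul (hO w hw) (matNorm_hess_le_regBarrier h hν hw z) (matNorm_nonneg _ _) hε

/-- The same nonnegative multiple of the identity is added to the matrix and to the Hessian, so the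
relative accuracy does not get worse. -/
lemma isLandmark_regHess (h : IsSelfConcordant K Ψ M) (hν : 0 ≤ ν)
    {O : Vec d → Mat d × Mat d} (hO : IsHessianOracle K Ψ 0.001 O) {u : Vec d}
    (hu : u ∈ interior K) :
    IsLandmark K (regBarrier Ψ ν R) u (regHess O (ν / R ^ 2) u).val.1 := by
  obtain ⟨-, h1, h2, -, -⟩ := hO u hu
  have hc := h.contDiffAt hu
  have ha : 0 ≤ ν / R ^ 2 := by positivity
  rw [regHess_fst]
  refine ⟨hu, ?_, fun z => ?_, fun z => ?_⟩
  · have hs : (O u).1.IsSymm := by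
      have h3 : ((O u).1 - (1 - 0.001 : ℝ) • hess Ψ u).IsSymm := by
        have := h1.isHermitian
        rwa [Matrix.isHermitian_iff_isSymm] at this
      have := h3.add ((h.isSymm hu).smul (1 - 0.001 : ℝ))
      rwa [sub_add_cancel] at this
    exact hs.add (Matrix.isSymm_one.smul _)
  · have h3 := posSemidef_sub_quad_le h1 z
    rw [quad_matrix_smul] at h3
    rw [quad_hess_regBarrier hc, quad_add_smul_one]
    have h4 := mul_nonneg ha (sq_nonneg ‖z‖)
    norm_num at h3 ⊢
    linarith
  · have h3 := posSemidef_sub_quad_le h2 z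
    rw [quad_matrix_smul] at h3
    rw [quad_hess_regBarrier hc, quad_add_smul_one]
    have h4 := mul_nonneg ha (sq_nonneg ‖z‖)
    norm_num at h3 ⊢
    linarith

end Oracles

/-! ### Invariants of a round -/

section Invariants

variable {K : Set (Vec d)} {f : Vec d → ℝ} {M ε β : ℝ} {gradO : Vec d → Comp (Vec d)}
  {hessO : Vec d → Comp (Mat d × Mat d)} {η : ℝ} {m : ℕ}

/-- The inner loop approaches the minimizer geometrically and stays in `int K`. -/
lemma newtonSteps_spec (hf : IsSelfConcordant K f M) (hb : Bornology.IsBounded K)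
    (hK : Convex ℝ K) (hε : 0 ≤ ε) (hεM : M * ε ≤ 1 / 20000) {u : Vec d} {H : Mat d}
    (hL : IsLandmark K f u H)
    (hO : ∀ w ∈ interior K, ∀ z, |inner ℝ ((gradO w).val - gradient f w) z|
      ≤ ε * matNorm (hess f w) z)
    {wmin s : Vec d} (hmin : wmin ∈ interior K) (hgrad : gradient f wmin = -s)
    (hmu : M * matNorm H (wmin - u) ≤ 0.027) (n : ℕ) (w : Vec d) (hw : w ∈ interior K)
    (hwm : M * matNorm H (w - wmin) ≤ 0.0025) :
    (newtonSteps gradO H⁻¹ s n w).val ∈ interior K ∧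
    matNorm H ((newtonSteps gradO H⁻¹ s n w).val - wmin)
      ≤ 0.1 ^ n * matNorm H (w - wmin) + 1.25 * (1 - 0.1 ^ n) * ε := by
  induction n generalizing w with
  | zero => simpa [newtonSteps] using hw
  | succ n ih =>
    obtain ⟨h1, h2⟩ := hL.newton_step hf hb hK hε hεM hw hmin hgrad hmu hwm (hO w hw)
    have h3 := mul_le_mul_of_nonneg_left h2 hf.const_nonneg
    obtain ⟨h4, h5⟩ := ih _ h1 (by linarith)
    refine ⟨h4, h5.trans ?_⟩
    -- The recursion `e ↦ 0.1 e + 1.1 ε` has fixed point `(1.1 / 0.9) ε ≤ 1.25 ε`.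
    have hp : (0 : ℝ) ≤ 0.1 ^ n := by positivity
    have h6 := mul_le_mul_of_nonneg_left h2 hp
    have h7 := mul_nonneg hp hε
    rw [pow_succ]
    linarith

/-- The state of BARONS at the start of a round, with `wmin` the minimizer that it tracks. -/
structure IsTracking (K : Set (Vec d)) (f : Vec d → ℝ) (M ε : ℝ) (wmin : Vec d) (σ : Store d) :
    Prop where
  mem : σ.w ∈ interior K
  landmark : IsLandmark K f σ.u σ.H
  inv : σ.Hinv = σ.H⁻¹
  near_landmark : matNorm σ.H (σ.w - σ.u) ≤ 1 / (41 * M)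
  near_min : matNorm σ.H (σ.w - wmin) ≤ 3 * ε

/-- The estimates of one round, all in the norm of the old landmark. The error `2.5 ε` leaves room
to switch norms and return to `3 ε`; the third bound compares the point being played with the next
minimizer, which the regret needs; the last keeps the new point in the range where the old landmark
is valid. -/
lemma IsTracking.nextPoint_spec (hf : IsSelfConcordant K f M) (hb : Bornology.IsBounded K)
    (hK : Convex ℝ K) (hM : 0 < M) (hε : 0 ≤ ε) (hεM : M * ε ≤ 1 / 20000) (hβ : 0 ≤ β)
    (hβM : M * β ≤ 1 / 1000)
    (hm : (0.1 : ℝ) ^ (m - 1) ≤ 3 * (M * ε))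
    (hO : ∀ w ∈ interior K, ∀ z, |inner ℝ ((gradO w).val - gradient f w) z|
      ≤ ε * matNorm (hess f w) z)
    {wmin wmin' g : Vec d} {σ : Store d} (hσ : IsTracking K f M ε wmin σ)
    (hmin : wmin ∈ interior K) (hmin' : wmin' ∈ interior K)
    (hgrad : gradient f wmin = -σ.s) (hgrad' : gradient f wmin' = -(σ.s + η • g))
    (hg : ∀ w ∈ interior K, ∀ z, |inner ℝ (η • g) z| ≤ β * matNorm (hess f w) z) :
    nextPoint gradO η m g σ ∈ interior K ∧
    matNorm σ.H (nextPoint gradO η m g σ - wmin') ≤ 2.5 * ε ∧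
    matNorm σ.H (σ.w - wmin') ≤ 3 * ε + 1.07 * β ∧
    M * matNorm σ.H (nextPoint gradO η m g σ - σ.u) ≤ 0.03 := by
  have hL := hσ.landmark
  have hwu : M * matNorm σ.H (σ.w - σ.u) ≤ 1 / 41 := by
    have := mul_le_mul_of_nonneg_left hσ.near_landmark hM.le
    rwa [show M * (1 / (41 * M)) = 1 / 41 by field_simp] at this
  have hmu : M * matNorm σ.H (wmin - σ.u) ≤ 0.0246 := by
    have h1 := hL.triangle hf hb wmin σ.w σ.u
    have h2 := hσ.near_min
    rw [matNorm_sub_comm] at h2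
    have h3 := mul_le_mul_of_nonneg_left (h1.trans (add_le_add_left h2 _)) hM.le
    linarith
  -- `1.002` from the stability of minimizers times `1.06` from passing to the landmark norm.
  have hmove : matNorm σ.H (wmin' - wmin) ≤ 1.07 * β := by
    have h1 := matNorm_minimizer_sub_le hf hb hK hβ hβM hmin hmin' hgrad hgrad'
      (hg wmin hmin (wmin' - wmin))
    have h2 := hL.matNorm_le_hess hf hb hK (y := wmin) (by linarith) (wmin' - wmin)
    linarith
  have hwm' : matNorm σ.H (σ.w - wmin') ≤ 3 * ε + 1.07 * β := by
    have h1 := hL.triangle hf hb σ.w wmin wmin'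
    rw [matNorm_sub_comm σ.H wmin wmin'] at h1
    linarith [hσ.near_min]
  have hMwm := mul_le_mul_of_nonneg_left hwm' hM.le
  have hmu' : M * matNorm σ.H (wmin' - σ.u) ≤ 0.0257 := by
    have h1 := hL.triangle hf hb wmin' wmin σ.u
    have h3 := mul_le_mul_of_nonneg_left (h1.trans (add_le_add_left hmove _)) hM.le
    linarith
  obtain ⟨h1, h2⟩ := newtonSteps_spec hf hb hK hε hεM hL hO hmin' hgrad' (by linarith) (m - 1)
    σ.w hσ.mem (by linarith)
  rw [← hσ.inv] at h1 h2
  have hclose : matNorm σ.H (nextPoint gradO η m g σ - wmin') ≤ 2.5 * ε := by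
    refine h2.trans ?_
    have h0 : (0 : ℝ) ≤ 0.1 ^ (m - 1) := by positivity
    have h3 := mul_le_mul_of_nonneg_right hm (matNorm_nonneg σ.H (σ.w - wmin'))
    -- The initial error, damped by `0.1 ^ (m - 1) ≤ 3 M ε`, contributes at most `0.03 ε` beside the
    -- `1.25 ε` of the oracle.
    have h4 : ε * (M * matNorm σ.H (σ.w - wmin')) ≤ ε * 0.01 :=
      mul_le_mul_of_nonneg_left (by linarith) hε
    have h5 := mul_nonneg h0 hε
    linarith
  refine ⟨h1, hclose, hwm', ?_⟩
  have h6 := hL.triangle hf hb (nextPoint gradO η m g σ) wmin' σ.u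
  have h7 := mul_le_mul_of_nonneg_left (h6.trans (add_le_add_left hclose _)) hM.le
  linarith

lemma oneRound_s (g : Vec d) (σ : Store d) :
    (oneRound gradO hessO η M m g σ).val.s = σ.s + η • g := by
  rw [oneRound_val]; split_ifs <;> rfl

lemma IsTracking.oneRound (hf : IsSelfConcordant K f M) (hb : Bornology.IsBounded K)
    (hK : Convex ℝ K) (hM : 0 < M) (hε : 0 ≤ ε) (hεM : M * ε ≤ 1 / 20000) (hβ : 0 ≤ β)
    (hβM : M * β ≤ 1 / 1000)
    (hm : (0.1 : ℝ) ^ (m - 1) ≤ 3 * (M * ε))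
    (hO : ∀ w ∈ interior K, ∀ z, |inner ℝ ((gradO w).val - gradient f w) z|
      ≤ ε * matNorm (hess f w) z)
    (hO' : ∀ w ∈ interior K, IsLandmark K f w (hessO w).val.1)
    (hinv : ∀ w, (hessO w).val.2 = ((hessO w).val.1)⁻¹)
    {wmin wmin' g : Vec d} {σ : Store d} (hσ : IsTracking K f M ε wmin σ)
    (hmin : wmin ∈ interior K) (hmin' : wmin' ∈ interior K)
    (hgrad : gradient f wmin = -σ.s) (hgrad' : gradient f wmin' = -(σ.s + η • g))
    (hg : ∀ w ∈ interior K, ∀ z, |inner ℝ (η • g) z| ≤ β * matNorm (hess f w) z) :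
    IsTracking K f M ε wmin' (oneRound gradO hessO η M m g σ).val := by
  obtain ⟨h1, h2, -, h4⟩ := hσ.nextPoint_spec hf hb hK hM hε hεM hβ hβM hm hO hmin hmin' hgrad
    hgrad' hg
  rw [oneRound_val]
  split_ifs with h
  · exact ⟨h1, hσ.landmark, hσ.inv, h, h2.trans (by linarith)⟩
  · refine ⟨h1, hO' _ h1, hinv _, ?_, ?_⟩
    · simp only [sub_self, matNorm_zero]; positivity
    -- Changing the landmark costs a factor `1.06`, and `1.06 · 2.5 ≤ 3`.
    · have := hσ.landmark.matNorm_le hf hb hK (hO' _ h1) h4 (nextPoint gradO η m g σ - wmin')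
      linarith

/-- The potential that counts the landmarks: it grows by at most `6 ε + 1.07 β` in a round. -/
lemma IsTracking.potential_le (hf : IsSelfConcordant K f M) (hb : Bornology.IsBounded K)
    (hK : Convex ℝ K) (hM : 0 < M) (hε : 0 ≤ ε) (hεM : M * ε ≤ 1 / 20000) (hβ : 0 ≤ β)
    (hβM : M * β ≤ 1 / 1000)
    (hm : (0.1 : ℝ) ^ (m - 1) ≤ 3 * (M * ε))
    (hO : ∀ w ∈ interior K, ∀ z, |inner ℝ ((gradO w).val - gradient f w) z|
      ≤ ε * matNorm (hess f w) z)
    {wmin wmin' g : Vec d} {σ : Store d} (hσ : IsTracking K f M ε wmin σ)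
    (hmin : wmin ∈ interior K) (hmin' : wmin' ∈ interior K)
    (hgrad : gradient f wmin = -σ.s) (hgrad' : gradient f wmin' = -(σ.s + η • g))
    (hg : ∀ w ∈ interior K, ∀ z, |inner ℝ (η • g) z| ≤ β * matNorm (hess f w) z) :
    (if matNorm σ.H (nextPoint gradO η m g σ - σ.u) ≤ 1 / (41 * M) then 0 else 1 / (41 * M))
      + matNorm (Barons.oneRound gradO hessO η M m g σ).val.H
        ((Barons.oneRound gradO hessO η M m g σ).val.w
          - (Barons.oneRound gradO hessO η M m g σ).val.u)
      ≤ matNorm σ.H (σ.w - σ.u) + (6 * ε + 1.07 * β) := by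
  obtain ⟨-, h2, h3, -⟩ := hσ.nextPoint_spec hf hb hK hM hε hεM hβ hβM hm hO hmin hmin' hgrad
    hgrad' hg
  have h4 : matNorm σ.H (nextPoint gradO η m g σ - σ.u)
      ≤ matNorm σ.H (σ.w - σ.u) + (6 * ε + 1.07 * β) := by
    have e1 := hσ.landmark.triangle hf hb (nextPoint gradO η m g σ) wmin' σ.u
    have e2 := hσ.landmark.triangle hf hb wmin' σ.w σ.u
    rw [matNorm_sub_comm σ.H wmin' σ.w] at e2
    linarith
  rw [oneRound_val]
  split_ifs with h
  · simpa using h4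
  -- A landmark changes only when the distance exceeds `1 / (41 M)`, and the change resets the
  -- distance to zero; the lost distance pays for it.
  · simp only [sub_self, matNorm_zero]
    linarith

end Invariants

end Barons

namespace Barons

variable {d : ℕ} {K : Set (Vec d)} {f : Vec d → ℝ} {M ε β η : ℝ} {m : ℕ}
  {gradO : Vec d → Comp (Vec d)} {hessO : Vec d → Comp (Mat d × Mat d)}
  {wmin g : ℕ → Vec d}

/-! ### The whole run -/

lemma run_s (wstar : Vec d) (g : ℕ → Vec d) (t : ℕ) :
    (run gradO hessO η M m wstar g t).val.s = ∑ i ∈ Finset.range t, η • g i := by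
  induction t with
  | zero => rfl
  | succ t ih =>
    rw [Finset.sum_range_succ, ← ih]
    exact oneRound_s _ _

lemma run_isTracking (hf : IsSelfConcordant K f M) (hb : Bornology.IsBounded K)
    (hK : Convex ℝ K) (hM : 0 < M) (hε : 0 ≤ ε) (hεM : M * ε ≤ 1 / 20000) (hβ : 0 ≤ β)
    (hβM : M * β ≤ 1 / 1000)
    (hm : (0.1 : ℝ) ^ (m - 1) ≤ 3 * (M * ε))
    (hO : ∀ w ∈ interior K, ∀ z, |inner ℝ ((gradO w).val - gradient f w) z|
      ≤ ε * matNorm (hess f w) z)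
    (hO' : ∀ w ∈ interior K, IsLandmark K f w (hessO w).val.1)
    (hinv : ∀ w, (hessO w).val.2 = ((hessO w).val.1)⁻¹)
    (hmin : ∀ t, wmin t ∈ interior K)
    (hgrad : ∀ t, gradient f (wmin t) = -∑ i ∈ Finset.range t, η • g i) {T : ℕ}
    (hg : ∀ t < T, ∀ w ∈ interior K, ∀ z, |inner ℝ (η • g t) z| ≤ β * matNorm (hess f w) z)
    (t : ℕ) (ht : t ≤ T) :
    IsTracking K f M ε (wmin t) (run gradO hessO η M m (wmin 0) g t).val := by
  induction t with
  | zero =>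
    refine ⟨hmin 0, hO' _ (hmin 0), hinv _, ?_, ?_⟩
    · change matNorm _ (wmin 0 - wmin 0) ≤ _
      rw [sub_self, matNorm_zero]; positivity
    · change matNorm _ (wmin 0 - wmin 0) ≤ _
      rw [sub_self, matNorm_zero]; positivity
  | succ t ih =>
    refine (ih (by omega)).oneRound hf hb hK hM hε hεM hβ hβM hm hO hO' hinv (hmin t)
      (hmin (t + 1)) ?_ ?_ (hg t (by omega))
    · rw [run_s, hgrad]
    · rw [run_s, hgrad, Finset.sum_range_succ]

/-- Here `k` counts the landmark changes; the extra Hessian call is the one at the starting point.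
The telescoped potential bounds `k`, and the crude `k ≤ t` serves for the lower-order arithmetic. -/
lemma run_ops (hf : IsSelfConcordant K f M) (hb : Bornology.IsBounded K)
    (hK : Convex ℝ K) (hM : 0 < M) (hε : 0 ≤ ε) (hεM : M * ε ≤ 1 / 20000) (hβ : 0 ≤ β)
    (hβM : M * β ≤ 1 / 1000)
    (hm : (0.1 : ℝ) ^ (m - 1) ≤ 3 * (M * ε))
    (hO : ∀ w ∈ interior K, ∀ z, |inner ℝ ((gradO w).val - gradient f w) z|
      ≤ ε * matNorm (hess f w) z)
    (hO' : ∀ w ∈ interior K, IsLandmark K f w (hessO w).val.1)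
    (hinv : ∀ w, (hessO w).val.2 = ((hessO w).val.1)⁻¹)
    (hmin : ∀ t, wmin t ∈ interior K)
    (hgrad : ∀ t, gradient f (wmin t) = -∑ i ∈ Finset.range t, η • g i) {T : ℕ}
    (hg : ∀ t < T, ∀ w ∈ interior K, ∀ z, |inner ℝ (η • g t) z| ≤ β * matNorm (hess f w) z)
    {c c' : Tally} (hc : ∀ w, (gradO w).ops = c) (hc' : ∀ w, (hessO w).ops = c')
    (t : ℕ) (ht : t ≤ T) :
    ∃ k : ℕ, k ≤ t ∧ (run gradO hessO η M m (wmin 0) g t).ops =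
      (k + 1) • c' + t • ((m - 1) • (c + (2 * d ^ 2 + 2 * d) • tick Op.arith)
        + (2 * d ^ 2 + 5 * d + 2) • tick Op.arith) ∧
      k * (1 / (41 * M)) + matNorm (run gradO hessO η M m (wmin 0) g t).val.H
        ((run gradO hessO η M m (wmin 0) g t).val.w - (run gradO hessO η M m (wmin 0) g t).val.u)
        ≤ t * (6 * ε + 1.07 * β) := by
  induction t with
  | zero =>
    refine ⟨0, le_rfl, ?_, ?_⟩
    · simp [run, hc']
    · change _ + matNorm _ (wmin 0 - wmin 0) ≤ _
      simp [matNorm_zero]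
  | succ t ih =>
    obtain ⟨k, hkt, hops, hpot⟩ := ih (by omega)
    have htr := run_isTracking hf hb hK hM hε hεM hβ hβM hm hO hO' hinv hmin hgrad hg t (by omega)
    have hstep := htr.potential_le (hessO := hessO) (g := g t) (η := η) hf hb hK hM hε hεM hβ hβM hm
      hO (hmin t) (hmin (t + 1)) (by rw [run_s, hgrad])
      (by rw [run_s, hgrad, Finset.sum_range_succ]) (hg t (by omega))
    have hrun : run gradO hessO η M m (wmin 0) g (t + 1) =
        run gradO hessO η M m (wmin 0) g t >>= fun σ => oneRound gradO hessO η M m (g t) σ := rfl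
    rw [hrun, bind_ops, bind_val, oneRound_ops hc hc', hops]
    set σ := (run gradO hessO η M m (wmin 0) g t).val
    by_cases h : matNorm σ.H (nextPoint gradO η m (g t) σ - σ.u) ≤ 1 / (41 * M)
    · rw [if_pos h] at hstep ⊢
      refine ⟨k, by omega, ?_, ?_⟩
      · simp only [add_nsmul _ t 1, one_nsmul, add_zero]; abel
      · push_cast; linarith
    · rw [if_neg h] at hstep ⊢
      refine ⟨k + 1, by omega, ?_, ?_⟩
      · simp only [add_nsmul _ t 1, add_nsmul _ (k + 1) 1, one_nsmul]; abel
      · push_cast; linarith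

/-! ### Regret of the minimizers -/

/-- Playing the minimizer of the next round ("be the leader") has small regret. -/
lemma be_the_leader {U : Set (Vec d)} (hmem : ∀ t, wmin t ∈ U)
    (hmin : ∀ t, ∀ y ∈ U, f (wmin t) + inner ℝ (∑ i ∈ Finset.range t, η • g i) (wmin t)
      ≤ f y + inner ℝ (∑ i ∈ Finset.range t, η • g i) y) (n : ℕ) {y : Vec d} (hy : y ∈ U) :
    η * ∑ i ∈ Finset.range n, inner ℝ (g i) (wmin (i + 1) - y) ≤ f y - f (wmin 0) := by
  -- Each step tests the optimality of `wmin n` at `wmin (n + 1)`.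
  have key : ∀ n : ℕ, f (wmin 0) + η * ∑ i ∈ Finset.range n, inner ℝ (g i) (wmin (i + 1))
      ≤ f (wmin n) + inner ℝ (∑ i ∈ Finset.range n, η • g i) (wmin n) := by
    intro n
    induction n with
    | zero => simp
    | succ n ih =>
      have h1 := hmin n (wmin (n + 1)) (hmem _)
      rw [Finset.sum_range_succ, Finset.sum_range_succ, inner_add_left, inner_smul_left, mul_add]
      simp only [conj_trivial]
      linarith
  have h1 := (key n).trans (hmin n y hy)
  rw [sum_inner] at h1
  simp only [inner_smul_left, conj_trivial, ← Finset.mul_sum] at h1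
  simp only [inner_sub_right, Finset.sum_sub_distrib, mul_sub]
  linarith

/-- The minimizer of index 0 is set to the given `wstar`, so uniqueness of minimizers is not needed.
-/
lemma exists_minimizers {Ψ : Vec d → ℝ} (hf : IsSelfConcordant K Ψ M) (hK : IsCompact K)
    {wstar : Vec d} (hw : wstar ∈ interior K) (hmin : IsMinOn Ψ (interior K) wstar) (η : ℝ)
    (g : ℕ → Vec d) :
    ∃ wmin : ℕ → Vec d, wmin 0 = wstar ∧ (∀ t, wmin t ∈ interior K) ∧
      (∀ t, gradient Ψ (wmin t) = -∑ i ∈ Finset.range t, η • g i) ∧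
      ∀ t, ∀ y ∈ interior K, Ψ (wmin t) + inner ℝ (∑ i ∈ Finset.range t, η • g i) (wmin t)
        ≤ Ψ y + inner ℝ (∑ i ∈ Finset.range t, η • g i) y := by
  choose W hW1 hW2 hW3 using fun t : ℕ =>
    hf.exists_gradient_eq_neg hK ⟨wstar, hw⟩ (∑ i ∈ Finset.range t, η • g i)
  refine ⟨fun t => if t = 0 then wstar else W t, rfl, fun t => ?_, fun t => ?_, fun t => ?_⟩
  · by_cases h : t = 0
    · simpa [h] using hw
    · simpa [h] using hW1 t
  · by_cases h : t = 0
    · have h0 := (hmin.isLocalMin (isOpen_interior.mem_nhds hw)).fderiv_eq_zero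
      simp [h, gradient, h0]
    · simpa [h] using hW2 t
  · by_cases h : t = 0
    · intro y hy
      simpa [h] using hmin hy
    · simpa [h] using hW3 t

/-! ### Pricing the tally and the number of Newton steps -/

lemma price_of_ops {k t n : ℕ} (hn : 1 ≤ n) {ops : Tally}
    (h : ops = (k + 1) • (tick Op.hessCall + d • tick Op.arith + tick Op.matInv)
      + t • ((n - 1) • (tick Op.gradCall + (2 * d) • tick Op.arith
        + (2 * d ^ 2 + 2 * d) • tick Op.arith) + (2 * d ^ 2 + 5 * d + 2) • tick Op.arith))
    (Cgrad Chess Cinv : ℝ) :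
    ops.price Cgrad Chess Cinv = Cgrad * (t * (n - 1)) + (Chess + Cinv) * (k + 1)
      + ((k + 1) * d + t * ((n - 1) * (2 * d ^ 2 + 4 * d) + (2 * d ^ 2 + 5 * d + 2))) := by
  subst h
  simp only [Tally.price, tick, Pi.add_apply, Pi.smul_apply, Pi.single_apply, smul_eq_mul]
  simp [Nat.cast_sub hn]
  ring

/-- The geometric decrease over `m - 1` Newton steps when `m ≥ log (1 / x)`. -/
lemma pow_le_three_mul {x : ℝ} (hx : 0 < x) (hm1 : 1 ≤ m) (hm : Real.log (1 / x) ≤ m) :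
    (0.1 : ℝ) ^ (m - 1) ≤ 3 * x := by
  have e1 : (0.1 : ℝ) ≤ Real.exp (-1) := by
    rw [Real.exp_neg, le_inv_comm₀ (by norm_num) (Real.exp_pos _)]
    have := Real.exp_one_lt_d9
    norm_num; linarith
  -- Doing `m - 1` rather than `m` steps costs a factor `e ≤ 3`.
  have e2 : (0.1 : ℝ) ^ (m - 1) ≤ Real.exp (1 - m) := by
    refine (pow_le_pow_left₀ (by norm_num) e1 _).trans (le_of_eq ?_)
    rw [← Real.exp_nat_mul, Nat.cast_sub hm1]
    congr 1; push_cast; ring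
  refine e2.trans ?_
  rw [sub_eq_add_neg, Real.exp_add]
  have e3 : Real.exp (-(m : ℝ)) ≤ x := by
    rw [one_div, Real.log_inv] at hm
    calc Real.exp (-(m : ℝ)) ≤ Real.exp (Real.log x) := Real.exp_le_exp.2 (by linarith)
      _ = x := Real.exp_log hx
  have e4 := Real.exp_one_lt_d9
  exact mul_le_mul (by linarith) e3 (Real.exp_pos _).le (by norm_num)

end Barons

namespace Barons

/-! ### The parameters -/

section Parameters

variable {M ν R G η ε : ℝ} {T : ℕ}

/-- For the parameters of the theorem, `T` is large. -/
lemma horizon_ge (hM : 0 < M) (hMν : 1 ≤ M * Real.sqrt ν) (hT : 1 ≤ T)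
    (hε : ε = Real.sqrt (ν / T)) (hεM : ε ≤ 1 / (20000 * M)) :
    20000 ≤ Real.sqrt T := by
  have hT0 : (0 : ℝ) < T := by exact_mod_cast hT
  have hs := Real.sqrt_pos.2 hT0
  rw [hε, Real.sqrt_div' _ hT0.le, div_le_div_iff₀ hs (by positivity)] at hεM
  linarith

lemma one_le_log_horizon (h : 20000 ≤ Real.sqrt T) : 1 ≤ Real.log T := by
  have hT0 : (20000 : ℝ) ^ 2 ≤ T := by
    have := pow_le_pow_left₀ (by norm_num) h 2
    rwa [Real.sq_sqrt (Nat.cast_nonneg T)] at this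
  rw [Real.le_log_iff_exp_le (by linarith)]
  have := Real.exp_one_lt_d9
  linarith

lemma mul_sqrt_div_eq {T a : ℝ} (hT : 0 < T) : T * Real.sqrt (a / T) = Real.sqrt (T * a) := by
  conv_lhs => rw [← Real.sqrt_sq hT.le, ← Real.sqrt_mul (sq_nonneg _), Real.sqrt_sq hT.le]
  congr 1; field_simp

lemma sqrt_div_mul_sqrt_eq {T a : ℝ} (hT : 0 < T) (ha : 0 ≤ a) :
    Real.sqrt (a / T) * Real.sqrt (T * a) = a := by
  rw [← Real.sqrt_mul (by positivity), show a / T * (T * a) = a ^ 2 by field_simp,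
    Real.sqrt_sq ha]

lemma log_inv_tolerance {T : ℝ} (hν : 0 < ν) (hM : 0 < M) (hT : 0 < T)
    (hε : ε = Real.sqrt (ν / T)) :
    Real.log (1 / (ε * M)) = Real.log (T / (ν * M ^ 2)) / 2 := by
  have h1 : (1 / (ε * M)) ^ 2 = T / (ν * M ^ 2) := by
    rw [div_pow, mul_pow, hε, Real.sq_sqrt (by positivity)]; field_simp
  rw [← h1, Real.log_pow]; push_cast; ring

lemma one_le_log_inv {x : ℝ} (hx : 0 < x) (hx1 : x ≤ 1 / 20000) : 1 ≤ Real.log (1 / x) := by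
  rw [Real.le_log_iff_exp_le (by positivity), le_div_iff₀ hx]
  have := Real.exp_one_lt_d9
  nlinarith

/-- The number of landmarks, from the potential. -/
lemma landmarks_le {T X L β k S : ℝ} (hM : 0 < M) (hT : 0 ≤ T)
    (hTβ : T * β = Real.sqrt ν * X) (hX : X ≤ 3 / 2 * Real.sqrt (T * L)) (hεβ : ε ≤ β)
    (hS : M * (Real.sqrt ν * Real.sqrt (T * L)) = S)
    (hk : k * (1 / (41 * M)) ≤ T * (6 * ε + 1.07 * β)) : k ≤ 450 * S := by
  rw [mul_one_div, div_le_iff₀ (by positivity)] at hk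
  have h2 := mul_le_mul_of_nonneg_left hεβ hT
  have h3 := mul_le_mul_of_nonneg_left hX (Real.sqrt_nonneg ν)
  -- `10.605 = (6 + 1.07) · 3 / 2`, and `41 · 10.605 ≤ 450`.
  have h4 : T * (6 * ε + 1.07 * β) ≤ 10.605 * (Real.sqrt ν * Real.sqrt (T * L)) := by linarith
  have h5 := mul_le_mul_of_nonneg_right h4 (show 0 ≤ 41 * M by positivity)
  have h6 := mul_nonneg hM.le (mul_nonneg (Real.sqrt_nonneg ν) (Real.sqrt_nonneg (T * L)))
  linarith

end Parameters

/-- `RG √(T (log T + 1))` is at most `3/2` times `RG √(T log T)`. -/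
lemma sqrt_mul_log_add_one_le {T : ℝ} (hT : 0 ≤ T) (hL : 1 ≤ Real.log T) :
    Real.sqrt (T * (Real.log T + 1)) ≤ 3 / 2 * Real.sqrt (T * Real.log T) := by
  refine Real.sqrt_le_iff.2 ⟨by positivity, ?_⟩
  rw [mul_pow, Real.sq_sqrt (by positivity)]
  nlinarith

/-- The tally of BARONS, priced. -/
lemma total_cost_le {c₁ Cgrad C d T m k S Λ : ℝ} (hc₁ : 1 ≤ c₁) (hCg : 0 ≤ Cgrad) (hC : 0 ≤ C)
    (hd : 1 ≤ d) (hT : 1 ≤ T) (hm : 1 ≤ m) (hkT : k ≤ T) (hkS : k ≤ 450 * S)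
    (hS : 1 ≤ S) (hΛ : 2 ≤ Λ) (hmΛ : m ≤ c₁ * Λ) :
    Cgrad * (T * (m - 1)) + C * (k + 1)
      + ((k + 1) * d + T * ((m - 1) * (2 * d ^ 2 + 4 * d) + (2 * d ^ 2 + 5 * d + 2)))
      ≤ (500 + 12 * c₁) * ((Cgrad + d ^ 2) * T * Λ + C * S) := by
  have hT0 : 0 ≤ T := by linarith
  have hdd : d ≤ d ^ 2 := by nlinarith
  have hcΛ : 0 ≤ c₁ * Λ := by linarith
  have p1 : Cgrad * (T * (m - 1)) ≤ (500 + 12 * c₁) * (Cgrad * T * Λ) := by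
    have h1 : m - 1 ≤ (500 + 12 * c₁) * Λ := by linarith
    calc Cgrad * (T * (m - 1)) = Cgrad * T * (m - 1) := by ring
      _ ≤ Cgrad * T * ((500 + 12 * c₁) * Λ) :=
        mul_le_mul_of_nonneg_left h1 (mul_nonneg hCg hT0)
      _ = _ := by ring
  have p2 : C * (k + 1) ≤ (500 + 12 * c₁) * (C * S) := by
    have h0 : 0 ≤ c₁ * S := mul_nonneg (by linarith) (by linarith)
    have h1 : k + 1 ≤ (500 + 12 * c₁) * S := by linarith
    calc C * (k + 1) ≤ C * ((500 + 12 * c₁) * S) := mul_le_mul_of_nonneg_left h1 hC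
      _ = _ := by ring
  have p3 : (k + 1) * d + T * ((m - 1) * (2 * d ^ 2 + 4 * d) + (2 * d ^ 2 + 5 * d + 2))
      ≤ (500 + 12 * c₁) * (d ^ 2 * T * Λ) := by
    -- The diagonal additions are charged to the `T d²` term through `k ≤ T`.
    have h1 : (k + 1) * d ≤ (2 * T) * d ^ 2 :=
      mul_le_mul (by linarith) hdd (by linarith) (by linarith)
    have h2 : (m - 1) * (2 * d ^ 2 + 4 * d) ≤ c₁ * Λ * (6 * d ^ 2) :=
      mul_le_mul (by linarith) (by linarith) (by linarith [sq_nonneg d]) hcΛ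
    have h3 : 2 * d ^ 2 + 5 * d + 2 ≤ 9 * d ^ 2 := by linarith
    have h4 := mul_le_mul_of_nonneg_left (add_le_add h2 h3) hT0
    have h5 : 0 ≤ d ^ 2 * T := mul_nonneg (sq_nonneg d) hT0
    have h6 := mul_le_mul_of_nonneg_left hΛ h5
    have h7 : 0 ≤ c₁ * (d ^ 2 * T * Λ) :=
      mul_nonneg (by linarith) (mul_nonneg h5 (by linarith))
    linarith
  linarith

/-- The regret of a sequence that stays close to the minimizers of the next round. -/
lemma regret_le {d : ℕ} {K : Set (Vec d)} {Ψ : Vec d → ℝ} {M ν R G η q X : ℝ} {T : ℕ}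
    {wstar w : Vec d} {l : ℕ → Vec d → ℝ} {g p wmin : ℕ → Vec d}
    (hΨ : IsSelfConcordantBarrier K Ψ M ν) (hb : Bornology.IsBounded K) (hK : Convex ℝ K)
    (hKR : K ⊆ Metric.closedBall 0 R) (hR : 0 < R) (hG : 0 < G) (hT : 1 ≤ T) (hν : 0 < ν)
    (hη0 : 0 < η) (hq0 : 0 < q) (hX1 : 1 ≤ X) (hη : η = ν / (R * G) * q)
    (hqX : q * X = Real.log T + 1) (hTq : T * q = X)
    (hw : wstar ∈ interior K) (hw' : w ∈ interior K)
    (hlead : ∀ y ∈ interior K, η * ∑ t ∈ Finset.range T, inner ℝ (g t) (wmin (t + 1) - y)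
      ≤ regBarrier Ψ ν R y - regBarrier Ψ ν R wstar)
    (hdist : ∀ t < T, ‖p t - wmin (t + 1)‖ ≤ R * (5 * q))
    (hsub : ∀ t < T, IsSubgradient K (l t) (p t) (g t)) (hgG : ∀ t < T, ‖g t‖ ≤ G) :
    ∑ t ∈ Finset.range T, (l t (p t) - l t w) ≤ 8 * (R * G * X) := by
  have hT0 : (0 : ℝ) < T := by exact_mod_cast hT
  have hT1 : (1 : ℝ) ≤ T := by exact_mod_cast hT
  set L := Real.log T with hLdef
  -- The barrier is unbounded near the frontier, so `w` is replaced by a point `y` a fraction `1 /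
  -- T` closer to `wstar`. This costs at most `2 R G` over all rounds, and `Ψ y - Ψ wstar ≤ ν log
  -- T`.
  set s : ℝ := 1 - 1 / T with hs
  have hs01 : s ∈ Set.Ico (0 : ℝ) 1 := by
    have h1 : 1 / (T : ℝ) ≤ 1 := (div_le_one hT0).2 hT1
    have h2 : 0 < 1 / (T : ℝ) := by positivity
    exact ⟨by linarith, by linarith⟩
  set y := wstar + s • (w - wstar) with hy
  have hyK : y ∈ interior K := IsSelfConcordant.segment_mem hK hw hw' ⟨hs01.1, hs01.2.le⟩
  have hball : ∀ x ∈ interior K, ‖x‖ ≤ R := fun x hx => by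
    simpa using hKR (interior_subset hx)
  have hΦy : regBarrier Ψ ν R y - regBarrier Ψ ν R wstar ≤ ν * (L + 1) := by
    have h1 := hΨ.line_sub_le hb hK hw hw' hs01
    have h2 : Real.log (1 - s) = -L := by
      rw [hs, sub_sub_cancel, one_div, Real.log_inv]
    rw [h2] at h1
    have h3 : ‖y‖ ^ 2 ≤ R ^ 2 := pow_le_pow_left₀ (norm_nonneg _) (hball y hyK) 2
    have h4 : ν / (2 * R ^ 2) * ‖y‖ ^ 2 ≤ ν / (2 * R ^ 2) * R ^ 2 := by gcongr
    have h5 : ν / (2 * R ^ 2) * R ^ 2 = ν / 2 := by field_simp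
    have h6 : 0 ≤ ν / (2 * R ^ 2) * ‖wstar‖ ^ 2 := by positivity
    simp only [regBarrier]
    linarith
  have hlead' : ∑ t ∈ Finset.range T, inner ℝ (g t) (wmin (t + 1) - y) ≤ R * G * X := by
    refine le_of_mul_le_mul_left ((hlead y hyK).trans (hΦy.trans (le_of_eq ?_))) hη0
    rw [← hqX, hη]; field_simp
  have hround : ∀ t ∈ Finset.range T, l t (p t) - l t w
      ≤ R * G * (5 * q) + inner ℝ (g t) (wmin (t + 1) - y) + 2 * (R * G) / T := by
    intro t ht
    rw [Finset.mem_range] at ht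
    have h1 := hsub t ht w (interior_subset hw')
    have h6 : inner ℝ (g t) (p t - wmin (t + 1)) ≤ G * (R * (5 * q)) :=
      (real_inner_le_norm _ _).trans
        (mul_le_mul (hgG t ht) (hdist t ht) (norm_nonneg _) hG.le)
    have h7 : ‖y - w‖ ≤ 2 * R / T := by
      have e : y - w = (1 / T : ℝ) • (wstar - w) := by
        rw [hy, hs]; module
      rw [e, norm_smul, Real.norm_of_nonneg (by positivity), one_div, ← div_eq_inv_mul]
      gcongr
      linarith [norm_sub_le wstar w, hball _ hw, hball _ hw']
    have h8 : inner ℝ (g t) (y - w) ≤ G * (2 * R / T) :=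
      (real_inner_le_norm _ _).trans (mul_le_mul (hgG t ht) h7 (norm_nonneg _) hG.le)
    -- Tracking error, regret of the next leader against `y`, and shift of the comparator; summed
    -- over the rounds they contribute `5 + 1 + 2 = 8` times `R G X`.
    have h9 : inner ℝ (g t) (w - p t) =
        -(inner ℝ (g t) (p t - wmin (t + 1)) + inner ℝ (g t) (wmin (t + 1) - y)
          + inner ℝ (g t) (y - w)) := by
      simp only [inner_sub_right]; ring
    have h10 : G * (2 * R / T) = 2 * (R * G) / T := by ring
    rw [h9] at h1
    linarith
  have hsum := Finset.sum_le_sum hround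
  rw [Finset.sum_add_distrib, Finset.sum_add_distrib, Finset.sum_const, Finset.sum_const,
    Finset.card_range, nsmul_eq_mul, nsmul_eq_mul] at hsum
  have e1 : (T : ℝ) * (R * G * (5 * q)) = 5 * (R * G * X) := by rw [← hTq]; ring
  have e2 : (T : ℝ) * (2 * (R * G) / T) = 2 * (R * G) := by field_simp
  rw [e1, e2] at hsum
  have e3 : R * G ≤ R * G * X := le_mul_of_one_le_right (by positivity) hX1
  linarith

end Barons

end

-- Adaptive losses are covered: `l` and `g` are tied to the run only through the subgradient
-- condition at its own iterates, and the iterate of round `t` depends only on earlier subgradients.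
set_option maxHeartbeats 800000 in
theorem theorem3 :
    ∃ c₀ : ℝ, 0 < c₀ ∧ ∃ Creg : ℝ, 0 < Creg ∧
    ∀ c₁ : ℝ, c₀ ≤ c₁ → ∃ Ccost : ℝ, 0 < Ccost ∧
    ∀ (d : ℕ) (K : Set (Barons.Vec d)) (Ψ : Barons.Vec d → ℝ) (M ν R G η ε : ℝ) (T m : ℕ)
      (Ograd : Barons.Vec d → Barons.Vec d)
      (Ohess : Barons.Vec d → Barons.Mat d × Barons.Mat d)
      (wstar : Barons.Vec d) (l : ℕ → Barons.Vec d → ℝ) (g : ℕ → Barons.Vec d)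
      (alg : ℕ → Barons.Comp (Barons.Store d)) (Cgrad Chess Cinv : ℝ),
    1 ≤ d → IsCompact K → Convex ℝ K → (interior K).Nonempty →
    0 < R → 0 < G → K ⊆ Metric.closedBall 0 R →
    Barons.IsSelfConcordantBarrier K Ψ M ν →
    -- the parameters
    1 ≤ T →
    η = ν / (R * G) * Real.sqrt ((Real.log T + 1) / T) →
    ε = Real.sqrt (ν / T) →
    c₀ * Real.log (1 / (ε * M)) ≤ m → m ≤ c₁ * Real.log (1 / (ε * M)) →
    -- `T` is large enough
    η ≤ 1 / (1000 * (R * G / Real.sqrt ν) * M) → ε ≤ 1 / (20000 * M) →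
    -- the oracles for `Ψ`, and the starting point
    Barons.IsGradientOracle K Ψ ε Ograd →
    Barons.IsHessianOracle K Ψ 0.001 Ohess →
    wstar ∈ interior K → IsMinOn (Barons.regBarrier Ψ ν R) (interior K) wstar →
    -- `alg` is BARONS on the subgradients `g` of the losses `l` at its own iterates
    alg = Barons.run (Barons.regGrad Ograd (ν / R ^ 2)) (Barons.regHess Ohess (ν / R ^ 2))
      η M m wstar g →
    (∀ t < T, ConvexOn ℝ K (l t)) →
    (∀ t < T, Barons.IsSubgradient K (l t) (alg t).val.w (g t)) →
    (∀ t < T, ‖g t‖ ≤ G) →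
    0 ≤ Cgrad → 0 ≤ Chess → 0 ≤ Cinv →
      (∀ t < T, (alg t).val.w ∈ interior K) ∧
      (∀ w ∈ interior K,
        ∑ t ∈ Finset.range T, (l t (alg t).val.w - l t w)
          ≤ Creg * (R * G * Real.sqrt (T * Real.log T))) ∧
      (alg T).ops.price Cgrad Chess Cinv
        ≤ Ccost * ((Cgrad + d ^ 2) * T * Real.log (T / (ν * M ^ 2))
          + (Chess + Cinv) * (M * Real.sqrt (T * ν * Real.log T))) := by
  -- `12 = 8 · 3 / 2`: the constant of `regret_le` times the price of replacing `log T + 1` by `log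
  -- T`.
  refine ⟨1, one_pos, 12, by norm_num, fun c₁ hc₁ => ⟨500 + 12 * c₁, by linarith, ?_⟩⟩
  intro d K Ψ M ν R G η ε T m Ograd Ohess wstar l g alg Cgrad Chess Cinv hd hKc hK _ hR hG hKR
    hΨ hT hη hε hm0 hm1 hηM hεM hOg hOh hw hwmin halg _ hsub hgG hCg hCh hCi
  have hb := hKc.isBounded
  have hsc := hΨ.toIsSelfConcordant
  -- sizes of the parameters
  have hMν : 1 ≤ M * Real.sqrt ν :=
    hΨ.one_le_mul_sqrt (v := EuclideanSpace.single ⟨0, hd⟩ (1 : ℝ)) hb hw (by simp)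
  have hM : 0 < M := by
    refine hsc.const_nonneg.lt_of_ne fun h => ?_
    rw [← h, zero_mul] at hMν; linarith
  have hsν : 0 < Real.sqrt ν := pos_of_mul_pos_right (lt_of_lt_of_le one_pos hMν) hM.le
  have hν : 0 < ν := Real.sqrt_pos.1 hsν
  have hT0 : (0 : ℝ) < T := by exact_mod_cast hT
  have hsT := Barons.horizon_ge hM hMν hT hε hεM
  have hL := Barons.one_le_log_horizon hsT
  set L := Real.log T with hLdef
  have hε0 : 0 < ε := by rw [hε]; positivity
  have hMε : M * ε ≤ 1 / 20000 := by
    rw [le_div_iff₀ (by positivity)] at hεM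
    linarith
  set q := Real.sqrt ((L + 1) / T) with hq
  have hq0 : 0 < q := Real.sqrt_pos.2 (by positivity)
  set X := Real.sqrt (T * (L + 1)) with hX
  have hTq : T * q = X := Barons.mul_sqrt_div_eq hT0
  have hqX : q * X = L + 1 := Barons.sqrt_div_mul_sqrt_eq hT0 (by linarith)
  have hη0 : 0 < η := by rw [hη]; positivity
  -- `β = η G R / √ν` bounds the dual local norm of `η • g t`.
  set β := Real.sqrt ν * q with hβ
  have hβ0 : 0 < β := by positivity
  have hνsq : Real.sqrt ν * Real.sqrt ν = ν := Real.mul_self_sqrt hν.le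
  have hβη : η * (R * G) = Real.sqrt ν * β := by
    rw [hη, hβ, ← mul_assoc (Real.sqrt ν), hνsq]; field_simp
  have hMβ : M * β ≤ 1 / 1000 := by
    rw [le_div_iff₀ (by positivity)] at hηM
    have e : η * (1000 * (R * G / Real.sqrt ν) * M) = 1000 * (M * β) := by
      have : η * (R * G) / Real.sqrt ν = β := by rw [hβη]; field_simp
      rw [← this]; ring
    rw [e] at hηM; linarith
  have hεβ : ε ≤ β := by
    rw [hε, hβ, hq, ← Real.sqrt_mul hν.le, ← mul_div_assoc]
    exact Real.sqrt_le_sqrt (div_le_div_of_nonneg_right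
      (le_mul_of_one_le_right hν.le (by linarith)) hT0.le)
  -- the number of Newton steps
  set Λ := Real.log (T / (ν * M ^ 2)) with hΛ
  have hlogΛ : Real.log (1 / (ε * M)) = Λ / 2 := Barons.log_inv_tolerance hν hM hT0 hε
  have hlog1 : 1 ≤ Real.log (1 / (ε * M)) :=
    Barons.one_le_log_inv (mul_pos hε0 hM) (by linarith)
  rw [one_mul] at hm0
  have hm1' : 1 ≤ m := by
    have : (1 : ℝ) ≤ m := hlog1.trans hm0
    exact_mod_cast this
  have hpow : (0.1 : ℝ) ^ (m - 1) ≤ 3 * (M * ε) :=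
    Barons.pow_le_three_mul (by positivity) hm1' (by rwa [mul_comm M ε])
  -- the regularized barrier and its oracles
  set Φ := Barons.regBarrier Ψ ν R with hΦ
  have hf : Barons.IsSelfConcordant K Φ M := Barons.isSelfConcordant_regBarrier hsc hν.le
  have hnorm : ∀ x ∈ interior K, ∀ v, Real.sqrt ν * ‖v‖ ≤ R * Barons.matNorm (Barons.hess Φ x) v :=
    fun x hx v => Barons.sqrt_mul_norm_le hsc hν.le hR hx v
  obtain ⟨wmin, hwmin0, hmem, hgrad, hopt⟩ :=
    Barons.exists_minimizers hf hKc hw hwmin η g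
  have hO := fun w (hw : w ∈ interior K) z =>
    Barons.abs_inner_regGrad_sub_le (R := R) hsc hb hν.le hε0.le hOg hw z
  have hO' := fun w (hw : w ∈ interior K) =>
    Barons.isLandmark_regHess (R := R) hsc hν.le hOh hw
  have hg : ∀ t < T, ∀ w ∈ interior K, ∀ z,
      |inner ℝ (η • g t) z| ≤ β * Barons.matNorm (Barons.hess Φ w) z := by
    intro t ht w hw z
    have h1 := abs_real_inner_le_norm (η • g t) z
    rw [norm_smul, Real.norm_of_nonneg hη0.le] at h1
    have h2 : η * ‖g t‖ * ‖z‖ ≤ η * G * ‖z‖ := by gcongr; exact hgG t ht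
    refine (h1.trans h2).trans (le_of_mul_le_mul_left ?_ hsν)
    have h3 := mul_le_mul_of_nonneg_left (hnorm w hw z) (mul_nonneg hη0.le hG.le)
    calc Real.sqrt ν * (η * G * ‖z‖) = η * G * (Real.sqrt ν * ‖z‖) := by ring
      _ ≤ η * G * (R * Barons.matNorm (Barons.hess Φ w) z) := h3
      _ = η * (R * G) * Barons.matNorm (Barons.hess Φ w) z := by ring
      _ = _ := by rw [hβη]; ring
  have htrack := Barons.run_isTracking (T := T) hf hb hK hM hε0.le hMε hβ0.le hMβ hpow hO hO'
    (fun _ => rfl) hmem hgrad hg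
  obtain ⟨k, hkT, hops, hpot⟩ := Barons.run_ops (T := T) hf hb hK hM hε0.le hMε hβ0.le hMβ hpow
    hO hO' (fun _ => rfl) hmem hgrad hg (fun w => Barons.regGrad_ops _ _ w)
    (fun w => Barons.regHess_ops _ _ w) T le_rfl
  rw [hwmin0, ← halg] at htrack hops hpot
  have hXle : X ≤ 3 / 2 * Real.sqrt (T * L) := Barons.sqrt_mul_log_add_one_le hT0.le hL
  have hX1 : 1 ≤ X := by
    rw [hX, Real.one_le_sqrt]
    have : (1 : ℝ) ≤ T := by exact_mod_cast hT
    nlinarith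
  refine ⟨fun t ht => (htrack t ht.le).mem, fun w hw' => ?_, ?_⟩
  · -- regret
    have hdist : ∀ t < T, ‖(alg t).val.w - wmin (t + 1)‖ ≤ R * (5 * q) := by
      intro t ht
      have htr := htrack t ht.le
      have hsσ : (alg t).val.s = ∑ i ∈ Finset.range t, η • g i := by
        rw [halg]; exact Barons.run_s _ _ _
      obtain ⟨-, -, h2, -⟩ := htr.nextPoint_spec (g := g t) (η := η) hf hb hK hM hε0.le hMε hβ0.le
        hMβ hpow hO (hmem t) (hmem (t + 1)) (by rw [hsσ, hgrad])
        (by rw [hsσ, hgrad, Finset.sum_range_succ]) (hg t ht)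
      have h3 := htr.landmark.matNorm_hess_le hf hb ((alg t).val.w - wmin (t + 1))
      have h4 := hnorm _ htr.landmark.mem ((alg t).val.w - wmin (t + 1))
      -- With `ε ≤ β`, `1.001 (3 ε + 1.07 β) ≤ 5 β`; dividing by `√ν` turns `β` into `q`.
      have h5 := mul_le_mul_of_nonneg_left
        (show Barons.matNorm (Barons.hess Φ (alg t).val.u) ((alg t).val.w - wmin (t + 1)) ≤ 5 * β by
          linarith) hR.le
      refine le_of_mul_le_mul_left (h4.trans (h5.trans (le_of_eq ?_))) hsν
      rw [hβ]; ring
    have hreg := Barons.regret_le hΨ hb hK hKR hR hG hT hν hη0 hq0 hX1 hη hqX hTq hw hw'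
      (fun y hy => hwmin0 ▸ Barons.be_the_leader hmem hopt T hy) hdist hsub hgG
    have hRG : 0 < R * G := by positivity
    have e4 := mul_le_mul_of_nonneg_left hXle hRG.le
    linarith
  · -- cost
    rw [Barons.price_of_ops hm1' hops]
    set S := M * Real.sqrt (T * ν * L) with hS
    have hSX : M * (Real.sqrt ν * Real.sqrt (T * L)) = S := by
      rw [hS, ← Real.sqrt_mul hν.le]; congr 2; ring
    have hTL : 1 ≤ Real.sqrt (T * L) := by
      rw [Real.one_le_sqrt]
      have : (1 : ℝ) ≤ T := by exact_mod_cast hT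
      nlinarith
    have hS1 : 1 ≤ S := by
      rw [← hSX, ← mul_assoc]
      exact hMν.trans (le_mul_of_one_le_right (by positivity) hTL)
    have hk : (k : ℝ) ≤ 450 * S := by
      refine Barons.landmarks_le (ε := ε) (β := β) hM hT0.le ?_ hXle hεβ hSX
        ((le_add_of_nonneg_right (Barons.matNorm_nonneg _ _)).trans hpot)
      rw [hβ, ← hTq]; ring
    have hΛ1 : 2 ≤ Λ := by linarith
    have hmΛ : (m : ℝ) ≤ c₁ * Λ := by
      rw [hlogΛ] at hm1
      have : 0 ≤ c₁ * Λ := by apply mul_nonneg <;> linarith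
      linarith
    have hm1R : (1 : ℝ) ≤ m := by exact_mod_cast hm1'
    have hd1 : (1 : ℝ) ≤ d := by exact_mod_cast hd
    have hT1 : (1 : ℝ) ≤ T := by exact_mod_cast hT
    have hkT' : (k : ℝ) ≤ T := by exact_mod_cast hkT
    exact Barons.total_cost_le hc₁ hCg (add_nonneg hCh hCi) hd1 hT1 hm1R hkT' hk hS1 hΛ1 hmΛ
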